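/- Let $0<r<R<\infty$ and $0<r_*<R_*<\infty$, and write $A(r,R)=\{z\in\mathbb{C} : r<|z|<R\}$. Suppose that $\log\frac{R}{r}\le \frac32$. Then there exists a harmonic homeomorphism of $A(r,R)$ onto $A(r_*,R_*)$, that is, a homeomorphism $h\colon A(r,R)\to A(r_*,R_*)$ that is harmonic as a complex-valued function on $A(r,R)$ (with no condition on its orientation or on the order of the boundary circles), if and only if $$\frac{R_*}{r_*}\ \ge\ \frac12\left(\frac{R}{r}+\frac{r}{R}\right).$$ -/

import Mathlib

/-- The open round annulus `A(r, R) = {z : r < |z| < R}` in the complex plane. -/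
def annulus (r R : ℝ) : Set ℂ := {z | r < ‖z‖ ∧ ‖z‖ < R}

/-- `h` is a harmonic homeomorphism of `U` onto `V`. The partial homeomorphism carries
bijectivity from source to target and continuity in both directions; its values outside the source
play no role. -/
def IsHarmonicHomeomorphism (h : OpenPartialHomeomorph ℂ ℂ) (U V : Set ℂ) : Prop :=
  h.source = U ∧ h.target = V ∧ InnerProductSpace.HarmonicOnNhd (h : ℂ → ℂ) U

/-! Necessity. Composing with `r * cexp z` and rescaling turns a harmonic homeomorphism into a
2πi-periodic harmonic map f of the strip 0 < Re z < T, T = log (R/r), into 1 < |w| < σ, σ = R_*/r_*;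
the bound to prove becomes cosh T ≤ σ. Let U(t) be the mean of |f|² over the line Re z = t. The
Fourier coefficients c_n(t) of f on these lines satisfy c_n'' = n² c_n, so U(t + τ) = ∑ |c_n(t +
τ)|² is a quadratic expression in the c_n(t) and c_n'(t). `exists_mode_bound` provides one μ ≥ 0,
independent of n, with |c_n(t + τ)|² ≥ (cosh² τ - μ)|c_n|² + μ n |c_n|² + 2 sinh τ cosh τ Re(c_n
conj c_n'). Summing over n yields U(t + τ) ≥ (cosh² τ - μ) U(t) + μ A(t) + sinh τ cosh τ U'(t),
where A = ∑ n |c_n|² is the mean of Im(conj f · ∂f/∂y). A degree argument (`two_pi_le_area`) gives A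
≥ 1. As U > 1 and U tends to 1 at the inner edge, there are t near 0 with U'(t) ≥ 0; letting t → 0
and then τ → T gives cosh² T ≤ σ². The hypothesis T ≤ 3/2 serves only to find μ: mode 0 wants it
large, the modes n ≥ 3 want it small.

The area bound rests on the form φ(|w|²) d arg w, whose exterior derivative is 2 φ'(|w|²) times the
area form: when f has positive Jacobian and φ is monotone, its integral over the image of a vertical
line increases with t. Lewy's theorem makes the Jacobian nonvanishing; conjugation fixes its sign
and z ↦ T - z the order of the edges.

Sufficiency. The map a z + b / conj z is radial and harmonic; a and b are fixed by the boundary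
radii, and its profile increases from r onwards when b ≤ a r², which is the stated inequality
rewritten. -/

/-! ### Hyperbolic inequalities for the individual Fourier modes -/

open Real in
-- The two numerical facts at the endpoint 3/2, both nearly sharp: the first dictates the constant
-- 1.099, and the second leaves just enough room for m = 1 + 1.099² in the modes n ≥ 3.
theorem sinh_mul_cosh_three_halves_le :
    sinh (3 / 2) * cosh (3 / 2) ≤ 3 / 2 * (1 + 1099 / 1000 * sinh (3 / 2)) ∧
      sinh (3 / 2) ^ 2 ≤ 4.56 := by
  have h1 := Real.exp_one_gt_d9
  have h2 := Real.exp_one_lt_d9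
  have h3 : exp (3 / 2) ^ 2 = exp 1 ^ 3 := by
    rw [← Real.exp_nat_mul, ← Real.exp_nat_mul]; norm_num
  have hp := Real.exp_pos (3 / 2)
  have l3 : (2.7182818 : ℝ) ^ 3 ≤ exp 1 ^ 3 := by gcongr; linarith
  have u3 : exp 1 ^ 3 ≤ (2.7182819 : ℝ) ^ 3 := by gcongr; linarith
  rw [← h3] at l3 u3
  have l : 4.48168 ≤ exp (3 / 2) := by nlinarith
  have u : exp (3 / 2) ≤ 4.4817 := by nlinarith
  have hn : exp (-(3 / 2)) = (exp (3 / 2))⁻¹ := Real.exp_neg _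
  have ln : 0.22312 ≤ exp (-(3 / 2)) := by
    rw [hn, le_inv_comm₀ (by norm_num) hp]; norm_num; linarith
  have un : exp (-(3 / 2)) ≤ 0.22314 := by
    rw [hn, inv_le_comm₀ hp (by norm_num)]; norm_num; linarith
  have hs := Real.sinh_eq (3 / 2)
  have hc := Real.cosh_eq (3 / 2)
  have sl : 2.12927 ≤ sinh (3 / 2) := by rw [hs]; linarith
  have su : sinh (3 / 2) ≤ 2.1293 := by rw [hs]; linarith
  have cu : cosh (3 / 2) ≤ 2.35243 := by rw [hc]; linarith
  constructor
  · nlinarith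
  · nlinarith

open Real in
-- As a power series in X = x², the function (sinh x cosh x - x)/x³ - (1.099/1.5) sinh x / x has
-- constant term ≤ 0 and all other coefficients ≥ 0. Hence its value at X is at most X/(9/4) times
-- its value at 9/4, so the sign at x = 3/2 settles the whole interval.
theorem sinh_mul_cosh_le {T : ℝ} (hT : 0 < T) (hT' : T ≤ 3 / 2) :
    sinh T * cosh T ≤ T * (1 + 1099 / 1000 * sinh T) := by
  have key : ∀ x : ℝ, 0 < x → HasSum (fun i : ℕ => ((4 : ℝ) ^ (i + 1) / (2 * (i + 1) + 1).factorial -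
      1099 / 1500 / (2 * i + 1).factorial) * (x ^ 2) ^ i)
      ((sinh x * cosh x - x) / x ^ 3 - 1099 / 1500 * sinh x / x) := by
    intro x hx
    have h1 := (Real.hasSum_sinh x).mul_left (1099 / 1500 / x)
    have h2 := (hasSum_nat_add_iff' 1).mpr (Real.hasSum_sinh (2 * x))
    have h3 := (h2.mul_left (1 / (2 * x ^ 3))).sub h1
    convert h3 using 1
    · rfl
    · funext i
      have e : (2 * x) ^ (2 * (i + 1) + 1) = 2 * 4 ^ (i + 1) * x ^ 3 * (x ^ 2) ^ i := by
        rw [mul_pow, pow_succ, pow_mul]; norm_num; ring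
      rw [e]
      field_simp
      ring
    · rw [Real.sinh_two_mul]
      simp
      field_simp
  have hk := key T hT
  have hk0 := key (3 / 2) (by norm_num)
  set d : ℕ → ℝ := fun i => (4 : ℝ) ^ (i + 1) / (2 * (i + 1) + 1).factorial -
      1099 / 1500 / (2 * i + 1).factorial with hd
  have hd0 : d 0 ≤ 0 := by norm_num [hd, Nat.factorial]
  have hdi : ∀ i, 1 ≤ i → 0 ≤ d i := by
    intro i hi
    simp only [hd]
    have e : ((2 * (i + 1) + 1).factorial : ℝ) = (2 * i + 3) * (2 * i + 2) * (2 * i + 1).factorial := by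
      rw [show 2 * (i + 1) + 1 = (2 * i + 1 + 1) + 1 by ring, Nat.factorial_succ, Nat.factorial_succ]
      push_cast; ring
    rw [e, sub_nonneg, div_le_div_iff₀ (by positivity) (by positivity)]
    have hg : (1099 / 1500 : ℝ) * ((2 * i + 3) * (2 * i + 2)) ≤ 4 ^ (i + 1) := by
      induction i, hi using Nat.le_induction with
      | base => norm_num
      | succ k hk ih =>
        have hk' : (1 : ℝ) ≤ k := by exact_mod_cast hk
        have := ih (by
          rw [show 2 * (k + 1) + 1 = (2 * k + 1 + 1) + 1 by ring, Nat.factorial_succ,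
            Nat.factorial_succ]
          push_cast; ring)
        rw [pow_succ]; push_cast; nlinarith
    have := mul_le_mul_of_nonneg_right hg (Nat.cast_nonneg (α := ℝ) (2 * i + 1).factorial)
    linarith
  have hX : T ^ 2 / (9 / 4) ≤ 1 := by rw [div_le_one (by norm_num)]; nlinarith
  have hX0 : 0 ≤ T ^ 2 / (9 / 4) := by positivity
  have hs := hasSum_le (f := fun i => d i * (T ^ 2) ^ i)
    (g := fun i => T ^ 2 / (9 / 4) * (d i * ((3 / 2) ^ 2) ^ i)) ?_ hk (hk0.mul_left _)
  · have hn := sinh_mul_cosh_three_halves_le.1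
    have h0 : (sinh (3 / 2) * cosh (3 / 2) - 3 / 2) / (3 / 2 : ℝ) ^ 3
        - 1099 / 1500 * sinh (3 / 2) / (3 / 2) ≤ 0 := by
      norm_num; linarith
    have h4 := hs.trans (mul_nonpos_of_nonneg_of_nonpos hX0 h0)
    rw [sub_nonpos, div_le_div_iff₀ (by positivity) hT] at h4
    have h5 : sinh T * cosh T - T ≤ 1099 / 1500 * sinh T * T ^ 2 :=
      le_of_mul_le_mul_right (by linarith) hT
    have hs0 := Real.sinh_pos_iff.mpr hT
    -- The series gives the bound with T²/1.5, which is at most T.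
    have := mul_le_mul_of_nonneg_left hT' (mul_pos hs0 hT).le
    nlinarith
  · intro i
    rcases i with _ | _ | i
    · simp; nlinarith
    · simp; apply le_of_eq; ring
    · have hY : (T ^ 2) ^ (i + 2) ≤ T ^ 2 / (9 / 4) * ((3 / 2) ^ 2) ^ (i + 2) := by
        have : (T ^ 2) ^ (i + 1) ≤ ((3 / 2) ^ 2) ^ (i + 1) := by gcongr
        rw [pow_succ _ (i + 1), pow_succ _ (i + 1)]
        nlinarith [sq_nonneg T]
      have := mul_le_mul_of_nonneg_left hY (hdi (i + 2) (by omega))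
      linarith

open Real in
-- This is tanh (nT) ≤ n tanh T with denominators cleared.
theorem sinh_nat_mul_mul_cosh_le {T : ℝ} (hT : 0 < T) (n : ℕ) :
    sinh (n * T) * cosh T ≤ n * sinh T * cosh (n * T) := by
  have hs := Real.sinh_pos_iff.mpr hT
  have hc := Real.one_le_cosh T
  induction n with
  | zero => simp
  | succ n ih =>
    have e : ((n + 1 : ℕ) : ℝ) * T = n * T + T := by push_cast; ring
    rw [e, Real.sinh_add, Real.cosh_add]
    push_cast
    have h0 : 0 ≤ sinh (n * T) := Real.sinh_nonneg_iff.mpr (by positivity)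
    have hC := Real.cosh_pos (n * T)
    nlinarith [mul_le_mul_of_nonneg_right ih (by linarith : 0 ≤ cosh T), mul_nonneg h0 (sq_nonneg (sinh T)), mul_nonneg (Nat.cast_nonneg (α := ℝ) n) (mul_nonneg h0 (sq_nonneg (sinh T)))]

open Real in
theorem three_mul_sinh_nat_mul_ge {T : ℝ} (hT : 0 < T) {n : ℕ} (hn : 3 ≤ n) :
    n * sinh (3 * T) ≤ 3 * sinh (n * T) := by
  induction n, hn using Nat.le_induction with
  | base => simp
  | succ n hn ih =>
    have e : ((n + 1 : ℕ) : ℝ) * T = n * T + T := by push_cast; ring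
    rw [e, Real.sinh_add]
    push_cast
    have hn' : (3 : ℝ) ≤ n := by exact_mod_cast hn
    have h1 := sinh_nat_mul_mul_cosh_le hT n
    have hs := Real.sinh_pos_iff.mpr hT
    have hc := Real.one_le_cosh T
    have h0 : 0 ≤ sinh (n * T) := Real.sinh_nonneg_iff.mpr (by positivity)
    have h3 : 0 ≤ sinh (3 * T) := Real.sinh_nonneg_iff.mpr (by positivity)
    have h4 : sinh (n * T) ≤ sinh (n * T) * cosh T := le_mul_of_one_le_right h0 hc
    refine le_of_mul_le_mul_left ?_ (by linarith : (0 : ℝ) < n)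
    nlinarith

theorem third_mode_bound {S m : ℝ} (hS : 0 ≤ S) (hm : m ≤ 2.21) :
    S + 1 + 2 * (m * S) ≤
      6 * (S + 1) * (4 * S + 1) / (4 * S + 3) - 9 * (S + 1) / (4 * S + 3) ^ 2 := by
  have h7 : 6 * (S + 1) * (4 * S + 1) / (4 * S + 3)
        - 9 * (S + 1) / (4 * S + 3) ^ 2 - (S + 1 + 2 * (m * S))
      = S * (4 * (S + 1) * (20 * S + 18) - 2 * m * (4 * S + 3) ^ 2) / (4 * S + 3) ^ 2 := by
    field_simp; ring
  have h8 : 0 ≤ 4 * (S + 1) * (20 * S + 18) - 2 * m * (4 * S + 3) ^ 2 := by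
    have := mul_le_mul_of_nonneg_right hm (sq_nonneg (4 * S + 3))
    have : 0 ≤ 9.28 * S ^ 2 + 45.92 * S + 32.22 := by positivity
    linarith
  have : 0 ≤ S * (4 * (S + 1) * (20 * S + 18) - 2 * m * (4 * S + 3) ^ 2) / (4 * S + 3) ^ 2 := by
    positivity
  linarith

/-- Applied with k = n coth (nT), K = 3 coth (3T), x = sinh T cosh T and q = cosh² T. It transfers
the inequality from mode 3 (`hbase`) to mode n: the growth of the right-hand side pays for the extra
(n - 3) μ. -/
theorem secant_bound {x K k μ q n : ℝ} (hn : 3 ≤ n) (hμ : 0 ≤ μ) (hx : 0 < x) (hk : 0 < k)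
    (hK : 0 < K) (hδ : 0 ≤ (K ^ 2 - 9) - (k ^ 2 - n ^ 2)) (hkK : 3 * k ≤ n * K)
    (hxk : 1 ≤ x * k) (hxK : 1 ≤ x * K) (h6 : μ * K ≤ 6 * x)
    (hbase : q + 2 * μ ≤ 2 * x * K - x ^ 2 * (K ^ 2 - 9)) :
    q + (n - 1) * μ ≤ 2 * x * k - x ^ 2 * (k ^ 2 - n ^ 2) := by
  obtain ⟨δ, hδd⟩ : ∃ δ, δ = (K ^ 2 - 9) - (k ^ 2 - n ^ 2) := ⟨_, rfl⟩
  rw [← hδd] at hδ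
  have hn3 : (0 : ℝ) ≤ n - 3 := by linarith
  have hstep : (n - 3) * μ ≤ 2 * x * (k - K) + x ^ 2 * δ := by
    -- The factor k + K turns k - K into k² - K² = n² - 9 - δ, and k + K ≤ (n + 3) K / 3.
    refine le_of_mul_le_mul_right ?_ (by positivity : 0 < k + K)
    have e1 : (2 * x * (k - K) + x ^ 2 * δ) * (k + K) =
        2 * x * (n ^ 2 - 9) + δ * x * (x * (k + K) - 2) := by
      rw [hδd]; ring
    have e2 : 0 ≤ δ * x * (x * (k + K) - 2) := by
      have : 0 ≤ x * (k + K) - 2 := by linarith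
      positivity
    have e3 : (n - 3) * μ * (k + K) ≤ (n - 3) * μ * ((n + 3) * K / 3) := by
      gcongr; linarith
    have e4 := mul_le_mul_of_nonneg_left h6 (mul_nonneg hn3 (by linarith : (0 : ℝ) ≤ (n + 3) / 3))
    rw [e1]; linarith
  have : x ^ 2 * (K ^ 2 - 9) = x ^ 2 * δ + x ^ 2 * (k ^ 2 - n ^ 2) := by rw [hδd]; ring
  linarith

open Real in
set_option maxHeartbeats 800000 in
-- Equality holds for n = 1, and n = 2 amounts to m ≤ 3. For n ≥ 3, division by sinh² (nT) gives an
-- inequality in k = n coth (nT), where k² - n² = n²/sinh² (nT). Mode 3 follows from m ≤ 2.21 and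
-- the later ones from `secant_bound`, whose condition μ K ≤ 6 x is exactly `hm`.
theorem mode_coeff_le_of_pos {T m : ℝ} (hT : 0 < T) (hm0 : 0 ≤ m) (hm3 : m ≤ 2.21)
    (hm : m * (4 * sinh T ^ 2 + 1) ≤ 2 * (4 * sinh T ^ 2 + 3)) {n : ℕ} (hn : 1 ≤ n) :
    (cosh T ^ 2 + (n - 1) * (m * sinh T ^ 2)) * sinh (n * T) ^ 2 ≤
      2 * n * cosh (n * T) * sinh (n * T) * (sinh T * cosh T)
        - n ^ 2 * (sinh T * cosh T) ^ 2 := by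
  have hs := Real.sinh_pos_iff.mpr hT
  have hc := Real.cosh_pos T
  have hcs := Real.cosh_sq T
  obtain rfl | rfl | h3 : n = 1 ∨ n = 2 ∨ 3 ≤ n := by omega
  · simp; nlinarith
  · push_cast
    rw [Real.sinh_two_mul, Real.cosh_two_mul]
    have : 0 ≤ (sinh T * cosh T) ^ 2 * sinh T ^ 2 * (3 - m) := by
      have : 0 ≤ 3 - m := by linarith
      positivity
    nlinarith
  · have hn' : (3 : ℝ) ≤ n := by exact_mod_cast h3
    have hsn : 0 < sinh (n * T) := Real.sinh_pos_iff.mpr (by positivity)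
    have hs3 : 0 < sinh (3 * T) := Real.sinh_pos_iff.mpr (by positivity)
    have e3s : sinh (3 * T) = sinh T * (4 * sinh T ^ 2 + 3) := by rw [Real.sinh_three_mul]; ring
    have e3c : cosh (3 * T) = cosh T * (4 * sinh T ^ 2 + 1) := by
      rw [Real.cosh_three_mul]; nlinarith
    set s := sinh T
    set c := cosh T
    set k := n * cosh (n * T) / sinh (n * T) with hk
    set K := 3 * cosh (3 * T) / sinh (3 * T) with hK
    have hkk : k * sinh (n * T) = n * cosh (n * T) := by rw [hk]; field_simp
    have hKK : K * sinh (3 * T) = 3 * cosh (3 * T) := by rw [hK]; field_simp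
    have hkp : 0 < k := by rw [hk]; have := Real.cosh_pos (n * T); positivity
    have hKp : 0 < K := by rw [hK]; have := Real.cosh_pos (3 * T); positivity
    have ek : k ^ 2 - n ^ 2 = n ^ 2 / sinh (n * T) ^ 2 := by
      rw [hk]; field_simp; rw [Real.cosh_sq]; ring
    have eK : K ^ 2 - 9 = 9 / sinh (3 * T) ^ 2 := by
      rw [hK]; field_simp; rw [Real.cosh_sq]; ring
    have hδ : 0 ≤ (K ^ 2 - 9) - (k ^ 2 - n ^ 2) := by
      rw [ek, eK, sub_nonneg, div_le_div_iff₀ (by positivity) (by positivity)]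
      have := three_mul_sinh_nat_mul_ge hT h3
      have := pow_le_pow_left₀ (by positivity) this 2
      nlinarith
    have hkK : 3 * k ≤ n * K := by
      have h0 : 0 ≤ sinh (n * T - 3 * T) := Real.sinh_nonneg_iff.mpr (by nlinarith)
      rw [Real.sinh_sub] at h0
      rw [hk, hK, ← mul_div_assoc, ← mul_div_assoc, div_le_div_iff₀ hsn hs3]
      have := mul_nonneg (by positivity : (0 : ℝ) ≤ 3 * n) h0
      nlinarith
    have hwk : 1 ≤ s * c * k := by
      have h1 := sinh_nat_mul_mul_cosh_le hT n
      have hc1 := Real.one_le_cosh T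
      rw [hk, ← mul_div_assoc, le_div_iff₀ hsn]
      have : (n * s * cosh (n * T)) * 1 ≤ (n * s * cosh (n * T)) * c := by
        have := Real.cosh_pos (n * T); gcongr
      nlinarith [mul_le_mul_of_nonneg_left hc1 hsn.le]
    have hwK : 1 ≤ s * c * K := by
      rw [hK, e3s, e3c, ← mul_div_assoc, le_div_iff₀ (by positivity)]
      nlinarith [mul_pos hs (pow_pos hs 2), mul_pos hs (pow_pos hs 4)]
    have hKs : K * (s * (4 * s ^ 2 + 3)) = 3 * (c * (4 * s ^ 2 + 1)) := by rw [← e3s, ← e3c, hKK]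
    have h6 : m * s ^ 2 * K ≤ 6 * (s * c) := by
      refine le_of_mul_le_mul_right ?_ (by positivity : 0 < s * (4 * s ^ 2 + 3))
      have := mul_le_mul_of_nonneg_left hm (by positivity : 0 ≤ s ^ 2 * c * 3)
      nlinarith
    have hbase : c ^ 2 + 2 * (m * s ^ 2) ≤ 2 * (s * c) * K - (s * c) ^ 2 * (K ^ 2 - 9) := by
      have : 2 * (s * c) * K - (s * c) ^ 2 * (K ^ 2 - 9) =
          6 * c ^ 2 * (4 * s ^ 2 + 1) / (4 * s ^ 2 + 3) - 9 * c ^ 2 / (4 * s ^ 2 + 3) ^ 2 := by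
        rw [eK, hK, e3s, e3c]; field_simp; ring
      rw [this, hcs]
      exact third_mode_bound (sq_nonneg s) hm3
    have hmain : c ^ 2 + (n - 1) * (m * s ^ 2) ≤
        2 * (s * c) * k - (s * c) ^ 2 * (k ^ 2 - n ^ 2) :=
      secant_bound hn' (by positivity) (by positivity) hkp hKp hδ hkK hwk hwK h6 hbase
    rw [ek] at hmain
    have h9 := mul_le_mul_of_nonneg_right hmain (sq_nonneg (sinh (n * T)))
    have e9 : (2 * (s * c) * k - (s * c) ^ 2 * (n ^ 2 / sinh (n * T) ^ 2)) * sinh (n * T) ^ 2 =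
        2 * n * cosh (n * T) * sinh (n * T) * (s * c) - n ^ 2 * (s * c) ^ 2 := by
      have : (2 * (s * c) * k) * sinh (n * T) ^ 2 = 2 * (s * c) * sinh (n * T) * (k * sinh (n * T)) := by
        ring
      rw [sub_mul, this, hkk]; field_simp
    linarith

/-! ### The mode inequality, uniform in the frequency -/

/-- The solution with initial value `α` and initial derivative `β` of `y'' = n² y`. -/
noncomputable def modeSol (n : ℤ) (α β : ℂ) (T : ℝ) : ℂ :=
  if n = 0 then α + T * β else Real.cosh (n * T) * α + (Real.sinh (n * T) / n : ℝ) * β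

theorem quadratic_form_le {a q s : ℝ} (hs : 0 < s) (h : q ^ 2 ≤ a * s ^ 2) (α β : ℂ) :
    0 ≤ a * ‖α‖ ^ 2 + 2 * q * (α.re * β.re + α.im * β.im) + s ^ 2 * ‖β‖ ^ 2 := by
  rw [← Complex.normSq_eq_norm_sq, ← Complex.normSq_eq_norm_sq, Complex.normSq_apply,
    Complex.normSq_apply]
  refine le_of_mul_le_mul_left ?_ (pow_pos hs 2)
  nlinarith [mul_le_mul_of_nonneg_right h (add_nonneg (mul_self_nonneg α.re) (mul_self_nonneg α.im)),
    sq_nonneg (q * α.re + s ^ 2 * β.re), sq_nonneg (q * α.im + s ^ 2 * β.im)]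

theorem norm_real_comb_sq (x y : ℝ) (α β : ℂ) : ‖(x : ℂ) * α + (y : ℂ) * β‖ ^ 2 =
    x ^ 2 * ‖α‖ ^ 2 + 2 * (x * y) * (α.re * β.re + α.im * β.im) + y ^ 2 * ‖β‖ ^ 2 := by
  rw [← Complex.normSq_eq_norm_sq, ← Complex.normSq_eq_norm_sq, ← Complex.normSq_eq_norm_sq,
    Complex.normSq_apply, Complex.normSq_apply, Complex.normSq_apply]
  simp
  ring

open Real in
-- For fixed n the difference of the two sides is a real quadratic form in (α, β), so each mode
-- reduces to a discriminant condition.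
theorem exists_mode_bound {T : ℝ} (hT : 0 < T) (hT' : T ≤ 3 / 2) :
    ∃ μ : ℝ, 0 ≤ μ ∧ ∀ (n : ℤ) (α β : ℂ),
      (cosh T ^ 2 - μ) * ‖α‖ ^ 2 + μ * (n * ‖α‖ ^ 2)
        + 2 * (sinh T * cosh T) * (α.re * β.re + α.im * β.im) ≤ ‖modeSol n α β T‖ ^ 2 := by
  have hs := Real.sinh_pos_iff.mpr hT
  have hc := Real.cosh_pos T
  have hcs := Real.cosh_sq T
  have hw := sinh_mul_cosh_le hT hT'
  have hTs : T ≤ sinh T := Real.self_le_sinh_iff.mpr hT.le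
  have hS : sinh T ^ 2 ≤ 4.56 := by
    refine le_trans ?_ sinh_mul_cosh_three_halves_le.2
    have := Real.sinh_le_sinh.mpr hT'
    gcongr
  -- With μ = m sinh² T, the discriminant condition for n = 0 reads (sinh T cosh T - T)² ≤ (m - 1)
  -- sinh² T · T², which `sinh_mul_cosh_le` supplies for this m.
  set m : ℝ := 1 + (1099 / 1000) ^ 2 with hm
  refine ⟨m * sinh T ^ 2, by positivity, fun n α β => ?_⟩
  by_cases hn : n = 0
  · subst hn
    have := norm_real_comb_sq 1 T α β
    simp only [Complex.ofReal_one, one_mul] at this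
    rw [modeSol, if_pos rfl, this]
    have hq : (T - sinh T * cosh T) ^ 2 ≤ (1 - (cosh T ^ 2 - m * sinh T ^ 2)) * T ^ 2 := by
      have h1 : 0 ≤ sinh T * cosh T - T := by
        nlinarith [Real.one_le_cosh T]
      have h2 : sinh T * cosh T - T ≤ 1099 / 1000 * sinh T * T := by linarith
      have h3 := pow_le_pow_left₀ h1 h2 2
      rw [hcs, hm]; nlinarith
    have := quadratic_form_le hT hq α β
    push_cast
    nlinarith
  · rw [modeSol, if_neg hn, norm_real_comb_sq]
    obtain ⟨k, hk⟩ : ∃ k : ℕ, k = n.natAbs := ⟨_, rfl⟩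
    have hk1 : 1 ≤ k := by omega
    have hkp : (0 : ℝ) < k := by exact_mod_cast hk1
    have hcoef := mode_coeff_le_of_pos hT (m := m) (by positivity) (by norm_num [hm])
      (by rw [hm]; nlinarith) hk1
    -- A negative n only makes the term μ n |α|² smaller, so the coefficient bound for |n| suffices.
    have hnk : (n : ℝ) ≤ k := by
      have : n ≤ (k : ℤ) := by omega
      exact_mod_cast this
    have hcosh : cosh (n * T) = cosh (k * T) := by
      rcases Int.natAbs_eq n with h | h <;> rw [h, ← hk] <;> simp
    have hsinh : sinh (n * T) / n = sinh (k * T) / k := by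
      rcases Int.natAbs_eq n with h | h <;> rw [h, ← hk] <;> simp [neg_div_neg_eq]
    rw [hcosh, hsinh]
    have hsk : 0 < sinh (k * T) := Real.sinh_pos_iff.mpr (by positivity)
    have hq : (cosh (k * T) * (sinh (k * T) / k) - sinh T * cosh T) ^ 2 ≤
        (cosh (k * T) ^ 2 - (cosh T ^ 2 - m * sinh T ^ 2) - n * (m * sinh T ^ 2))
          * (sinh (k * T) / k) ^ 2 := by
      have h1 : (n : ℝ) * (m * sinh T ^ 2) ≤ k * (m * sinh T ^ 2) := by gcongr
      have h2 : (cosh T ^ 2 + (k - 1) * (m * sinh T ^ 2)) * (sinh (k * T) / k) ^ 2 ≤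
          2 * cosh (k * T) * (sinh (k * T) / k) * (sinh T * cosh T) - (sinh T * cosh T) ^ 2 := by
        refine le_of_mul_le_mul_left ?_ (by positivity : (0 : ℝ) < k ^ 2)
        have e1 : (k : ℝ) ^ 2 * ((cosh T ^ 2 + (k - 1) * (m * sinh T ^ 2)) * (sinh (k * T) / k) ^ 2) =
            (cosh T ^ 2 + (k - 1) * (m * sinh T ^ 2)) * sinh (k * T) ^ 2 := by field_simp
        have e2 : (k : ℝ) ^ 2 * (2 * cosh (k * T) * (sinh (k * T) / k) * (sinh T * cosh T)
            - (sinh T * cosh T) ^ 2) = 2 * k * cosh (k * T) * sinh (k * T) * (sinh T * cosh T)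
            - k ^ 2 * (sinh T * cosh T) ^ 2 := by field_simp
        rw [e1, e2]; exact hcoef
      have h3 := mul_le_mul_of_nonneg_right h1 (sq_nonneg (sinh (k * T) / k))
      nlinarith
    have := quadratic_form_le (div_pos hsk hkp) hq α β
    nlinarith

/-! ### Calculus along the vertical lines of the strip -/

open Complex MeasureTheory Set Filter Topology InnerProductSpace
open scoped Real ContDiff ComplexConjugate

/-- The vertical strip `0 < re z < T`. -/
def strip (T : ℝ) : Set ℂ := {z | 0 < z.re ∧ z.re < T}

/-- The horizontal partial derivative. -/
noncomputable def dx (f : ℂ → ℂ) (z : ℂ) : ℂ := fderiv ℝ f z 1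

/-- The vertical partial derivative. -/
noncomputable def dy (f : ℂ → ℂ) (z : ℂ) : ℂ := fderiv ℝ f z I

theorem isOpen_strip (T : ℝ) : IsOpen (strip T) :=
  (isOpen_lt continuous_const continuous_re).inter (isOpen_lt continuous_re continuous_const)

theorem convex_strip (T : ℝ) : Convex ℝ (strip T) :=
  (convex_halfSpace_re_gt 0).inter (convex_halfSpace_re_lt T)

theorem add_mul_I_mem_strip {T t : ℝ} (ht : t ∈ Ioo 0 T) (θ : ℝ) : (t + θ * I : ℂ) ∈ strip T := by
  simpa [strip] using ht

section Smooth

variable {T : ℝ} {f : ℂ → ℂ}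

theorem contDiffOn_dx (hf : ContDiffOn ℝ ∞ f (strip T)) : ContDiffOn ℝ ∞ (dx f) (strip T) :=
  (hf.fderiv_of_isOpen (isOpen_strip T) (by simp)).clm_apply contDiffOn_const

theorem contDiffOn_dy (hf : ContDiffOn ℝ ∞ f (strip T)) : ContDiffOn ℝ ∞ (dy f) (strip T) :=
  (hf.fderiv_of_isOpen (isOpen_strip T) (by simp)).clm_apply contDiffOn_const

theorem differentiableAt_of_strip (hf : ContDiffOn ℝ ∞ f (strip T)) {z : ℂ} (hz : z ∈ strip T) :
    DifferentiableAt ℝ f z :=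
  (hf.contDiffAt ((isOpen_strip T).mem_nhds hz)).differentiableAt (by simp)

theorem hasDerivAt_dx (hf : ContDiffOn ℝ ∞ f (strip T)) {t : ℝ} (ht : t ∈ Ioo 0 T) (θ : ℝ) :
    HasDerivAt (fun s : ℝ => f (s + θ * I)) (dx f (t + θ * I)) t := by
  have h := (differentiableAt_of_strip hf (add_mul_I_mem_strip ht θ)).hasFDerivAt
  have h2 : HasDerivAt (fun s : ℝ => (s : ℂ) + θ * I) 1 t :=
    (Complex.ofRealCLM.hasDerivAt (x := t)).add_const _
  exact h.comp_hasDerivAt t h2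

theorem hasDerivAt_dy (hf : ContDiffOn ℝ ∞ f (strip T)) {t : ℝ} (ht : t ∈ Ioo 0 T) (θ : ℝ) :
    HasDerivAt (fun s : ℝ => f (t + s * I)) (dy f (t + θ * I)) θ := by
  have h := (differentiableAt_of_strip hf (add_mul_I_mem_strip ht θ)).hasFDerivAt
  have h2 : HasDerivAt (fun s : ℝ => (t : ℂ) + s * I) I θ := by
    simpa using ((Complex.ofRealCLM.hasDerivAt (x := θ)).mul_const I).const_add (t : ℂ)
  exact h.comp_hasDerivAt θ h2

theorem dx_dy_comm (hf : ContDiffOn ℝ ∞ f (strip T)) {z : ℂ} (hz : z ∈ strip T) :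
    dx (dy f) z = dy (dx f) z := by
  have hc := hf.contDiffAt ((isOpen_strip T).mem_nhds hz)
  have hs : IsSymmSndFDerivAt ℝ f z := hc.isSymmSndFDerivAt (by simpa using ENat.LEInfty.out)
  have hd : DifferentiableAt ℝ (fderiv ℝ f) z :=
    (hc.fderiv_right (m := ∞) (by simp)).differentiableAt (by simp)
  have e : ∀ v w : ℂ, fderiv ℝ (fun y => fderiv ℝ f y v) z w = fderiv ℝ (fderiv ℝ f) z w v := by
    intro v w
    rw [fderiv_clm_apply hd (differentiableAt_const v)]
    simp
  show fderiv ℝ (fun y => fderiv ℝ f y I) z 1 = fderiv ℝ (fun y => fderiv ℝ f y 1) z I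
  rw [e, e]
  exact hs 1 I

theorem dx_periodic (h : Function.Periodic f (2 * π * I)) : Function.Periodic (dx f) (2 * π * I) := by
  intro z
  have : (fun y => f (y + 2 * π * I)) = f := funext h
  rw [dx, dx, ← fderiv_comp_add_right, this]

theorem dy_periodic (h : Function.Periodic f (2 * π * I)) : Function.Periodic (dy f) (2 * π * I) := by
  intro z
  have : (fun y => f (y + 2 * π * I)) = f := funext h
  rw [dy, dy, ← fderiv_comp_add_right, this]

theorem continuous_vertical {E : Type*} [TopologicalSpace E] {g : ℂ → E}
    (hg : ContinuousOn g (strip T)) {t : ℝ} (ht : t ∈ Ioo 0 T) :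
    Continuous fun θ : ℝ => g (t + θ * I) :=
  hg.comp_continuous (by fun_prop) fun θ => add_mul_I_mem_strip ht θ

theorem hasDerivAt_integral_vertical {E : Type*} [NormedAddCommGroup E] [NormedSpace ℝ E]
    {g g' : ℂ → E} (hg : ContinuousOn g (strip T)) (hg' : ContinuousOn g' (strip T))
    (hd : ∀ t ∈ Ioo 0 T, ∀ θ : ℝ, HasDerivAt (fun s : ℝ => g (s + θ * I)) (g' (t + θ * I)) t)
    {t : ℝ} (ht : t ∈ Ioo 0 T) :
    HasDerivAt (fun s : ℝ => ∫ θ in (0 : ℝ)..2 * π, g (s + θ * I))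
      (∫ θ in (0 : ℝ)..2 * π, g' (t + θ * I)) t := by
  obtain ⟨a, ha, hat⟩ := exists_between ht.1
  obtain ⟨b, htb, hb⟩ := exists_between ht.2
  have hsub : Icc a b ⊆ Ioo 0 T := fun s hs => ⟨ha.trans_le hs.1, hs.2.trans_lt hb⟩
  have hK : IsCompact (Icc a b ×ˢ Icc (0 : ℝ) (2 * π)) := isCompact_Icc.prod isCompact_Icc
  have hcont : ContinuousOn (fun p : ℝ × ℝ => g' (p.1 + p.2 * I)) (Icc a b ×ˢ Icc (0 : ℝ) (2 * π)) :=
    hg'.comp (by fun_prop) fun p hp => add_mul_I_mem_strip (hsub hp.1) p.2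
  obtain ⟨C, hC⟩ := hK.exists_bound_of_continuousOn hcont
  refine (intervalIntegral.hasDerivAt_integral_of_dominated_loc_of_deriv_le (𝕜 := ℝ)
    (F := fun s θ => g (s + θ * I)) (F' := fun s θ => g' (s + θ * I)) (bound := fun _ => C)
    (Icc_mem_nhds hat htb) ?_ ?_ ?_ ?_ ?_ ?_).2
  · filter_upwards [Icc_mem_nhds hat htb] with s hs
    exact (continuous_vertical hg (hsub hs)).aestronglyMeasurable
  · exact (continuous_vertical hg ht).intervalIntegrable _ _
  · exact (continuous_vertical hg' ht).aestronglyMeasurable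
  · refine Eventually.of_forall fun θ hθ s hs => ?_
    rw [uIoc_of_le (by positivity)] at hθ
    exact hC (s, θ) ⟨hs, Ioc_subset_Icc_self hθ⟩
  · exact intervalIntegrable_const
  · exact Eventually.of_forall fun θ _ s hs => hd s (hsub hs) θ

end Smooth

/-! ### Fourier coefficients and Parseval's identity -/

section Fourier

/-- The `n`-th Fourier coefficient over the period interval `[0, 2π]`. -/
noncomputable def fc (g : ℝ → ℂ) (n : ℤ) : ℂ :=
  (2 * π : ℝ)⁻¹ • ∫ θ in (0 : ℝ)..2 * π, cexp (-(n * θ * I)) * g θ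

theorem fc_eq_fourierCoeffOn (g : ℝ → ℂ) (n : ℤ) :
    fc g n = fourierCoeffOn Real.two_pi_pos g n := by
  rw [fourierCoeffOn_eq_integral, fc, sub_zero, one_div]
  congr 1
  refine intervalIntegral.integral_congr fun θ _ => ?_
  simp only [fourier_coe_apply, smul_eq_mul]
  congr 2
  push_cast
  have : (π : ℂ) ≠ 0 := by exact_mod_cast Real.pi_ne_zero
  field_simp

theorem hasSum_norm_fc_sq {g : ℝ → ℂ} (hg : Continuous g) :
    HasSum (fun n => ‖fc g n‖ ^ 2) ((2 * π)⁻¹ * ∫ θ in (0 : ℝ)..2 * π, ‖g θ‖ ^ 2) := by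
  have hL : MemLp g 2 (volume.restrict (Ioc 0 (2 * π))) := by
    obtain ⟨C, hC⟩ := isCompact_Icc.exists_bound_of_continuousOn
      (hg.continuousOn (s := Icc 0 (2 * π)))
    refine MemLp.of_bound hg.aestronglyMeasurable C ?_
    exact (ae_restrict_iff' measurableSet_Ioc).mpr
      (Eventually.of_forall fun θ hθ => hC θ (Ioc_subset_Icc_self hθ))
  simpa [fc_eq_fourierCoeffOn] using hasSum_sq_fourierCoeffOn Real.two_pi_pos hL

theorem fc_add {g k : ℝ → ℂ} (hg : Continuous g) (hk : Continuous k) (n : ℤ) :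
    fc (fun θ => g θ + k θ) n = fc g n + fc k n := by
  simp only [fc, mul_add]
  rw [intervalIntegral.integral_add ((by fun_prop : Continuous _).intervalIntegrable _ _)
    ((by fun_prop : Continuous _).intervalIntegrable _ _), smul_add]

/-- Polarization of Parseval's identity. -/
theorem hasSum_inner_fc {g k : ℝ → ℂ} (hg : Continuous g) (hk : Continuous k) :
    HasSum (fun n => (fc g n).re * (fc k n).re + (fc g n).im * (fc k n).im)
      ((2 * π)⁻¹ * ∫ θ in (0 : ℝ)..2 * π, ((g θ).re * (k θ).re + (g θ).im * (k θ).im)) := by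
  have key : ∀ a b : ℂ, a.re * b.re + a.im * b.im = (‖a + b‖ ^ 2 - ‖a‖ ^ 2 - ‖b‖ ^ 2) * 2⁻¹ := by
    intro a b
    simp only [← normSq_eq_norm_sq, normSq_apply, add_re, add_im]
    ring
  have h := (((hasSum_norm_fc_sq (hg.add hk)).sub (hasSum_norm_fc_sq hg)).sub
    (hasSum_norm_fc_sq hk)).mul_right 2⁻¹
  simp only [key]
  convert h using 1
  · rfl
  · funext n; rw [← fc_add hg hk]; rfl
  · rw [intervalIntegral.integral_mul_const, intervalIntegral.integral_sub,
      intervalIntegral.integral_sub]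
    · simp only [Pi.add_apply]; ring
    all_goals exact (by fun_prop : Continuous _).intervalIntegrable _ _

theorem fc_deriv {g g' : ℝ → ℂ} (hd : ∀ θ, HasDerivAt g (g' θ) θ) (hg' : Continuous g')
    (hper : g (2 * π) = g 0) (n : ℤ) : fc g' n = n * I * fc g n := by
  have hg : Continuous g := continuous_iff_continuousAt.mpr fun θ => (hd θ).continuousAt
  have hexp : ∀ θ : ℝ, HasDerivAt (fun s : ℝ => cexp (-(n * s * I)))
      (cexp (-(n * θ * I)) * (-(n * I))) θ := by
    intro θ
    have h2 : HasDerivAt (fun s : ℝ => -((n : ℂ) * s * I)) (-(n * I)) θ := by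
      have := (((Complex.ofRealCLM.hasDerivAt (x := θ)).const_mul (n : ℂ)).mul_const I).neg
      rw [Complex.ofRealCLM_apply, ofReal_one, mul_one] at this
      exact this
    exact h2.cexp
  have h := intervalIntegral.integral_eq_sub_of_hasDerivAt (a := 0) (b := 2 * π)
    (fun θ _ => (hexp θ).mul (hd θ)) ((by fun_prop : Continuous _).intervalIntegrable _ _)
  rw [intervalIntegral.integral_add ((by fun_prop : Continuous _).intervalIntegrable _ _)
    ((by fun_prop : Continuous _).intervalIntegrable _ _)] at h
  have e1 : cexp (-(n * ((2 * π : ℝ) : ℂ) * I)) = 1 := by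
    rw [Complex.exp_eq_one_iff]; exact ⟨-n, by push_cast; ring⟩
  simp only [Pi.mul_apply, e1, hper] at h
  have e2 : ∫ θ in (0 : ℝ)..2 * π, cexp (-(n * θ * I)) * (-(n * I)) * g θ =
      -(n * I) * ∫ θ in (0 : ℝ)..2 * π, cexp (-(n * θ * I)) * g θ := by
    rw [← intervalIntegral.integral_const_mul]
    congr 1; funext θ; ring
  rw [e2] at h
  simp only [ofReal_zero, mul_zero, zero_mul, neg_zero, Complex.exp_zero, sub_self] at h
  simp only [fc, Complex.real_smul]
  linear_combination (((2 * π : ℝ)⁻¹ : ℝ) : ℂ) * h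

end Fourier

/-- A harmonic `2πi`-periodic map of the strip `0 < re z < T` into the annulus `1 < ‖w‖ < σ`
with positive Jacobian, sending the left edge to the inner circle and the right edge to the outer
circle. -/
structure IsHarmonicStripMap (T σ : ℝ) (f : ℂ → ℂ) : Prop where
  smooth : ContDiffOn ℝ ∞ f (strip T)
  periodic : Function.Periodic f (2 * π * I)
  laplace : ∀ z ∈ strip T, dx (dx f) z + dy (dy f) z = 0
  one_lt : ∀ z ∈ strip T, 1 < ‖f z‖
  lt : ∀ z ∈ strip T, ‖f z‖ < σ
  jac_pos : ∀ z ∈ strip T, 0 < (dx f z).re * (dy f z).im - (dx f z).im * (dy f z).re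
  inner : ∀ a, 1 < a → ∃ δ, 0 < δ ∧ ∀ z ∈ strip T, z.re < δ → ‖f z‖ < a
  outer : ∀ b, b < σ → ∃ δ, 0 < δ ∧ ∀ z ∈ strip T, T - δ < z.re → b < ‖f z‖

/-! ### Flux of φ(|w|²) d arg w, winding number and area -/

section Flux

theorem hasDerivAt_weighted_angle {F G : ℝ → ℂ} {F' G' : ℂ} {t : ℝ} (hF : HasDerivAt F F' t)
    (hG : HasDerivAt G G' t) (h0 : F t ≠ 0) {φ : ℝ → ℝ} (hφ : ContDiff ℝ 1 φ) :
    HasDerivAt (fun s => φ (normSq (F s)) * (G s / F s).im)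
      (deriv φ (normSq (F t)) * (2 * ((F t).re * F'.re + (F t).im * F'.im)) * (G t / F t).im
        + φ (normSq (F t)) * ((G' * F t - G t * F') / F t ^ 2).im) t := by
  have hre : HasDerivAt (fun s => (F s).re) F'.re t := reCLM.hasFDerivAt.comp_hasDerivAt t hF
  have him : HasDerivAt (fun s => (F s).im) F'.im t := imCLM.hasFDerivAt.comp_hasDerivAt t hF
  have hq : HasDerivAt (fun s => (G s / F s).im) ((G' * F t - G t * F') / F t ^ 2).im t :=
    imCLM.hasFDerivAt.comp_hasDerivAt t (hG.div hF h0)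
  have hn : HasDerivAt (fun s => normSq (F s)) (2 * ((F t).re * F'.re + (F t).im * F'.im)) t := by
    simp only [normSq_apply]
    exact ((hre.mul hre).add (him.mul him)).congr_deriv (by ring)
  have hφ' : HasDerivAt φ (deriv φ (normSq (F t))) (normSq (F t)) :=
    (hφ.differentiable (by simp) _).hasDerivAt
  exact (hφ'.comp t hn).mul hq

/-- The pointwise form of d(|w|²) ∧ d arg w = 2 du ∧ dv. -/
theorem jacobian_identity {a p q : ℂ} (ha : a ≠ 0) :
    (2 * (a.re * p.re + a.im * p.im)) * (q / a).im - (2 * (a.re * q.re + a.im * q.im)) * (p / a).im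
      = 2 * (p.re * q.im - p.im * q.re) := by
  have h : normSq a ≠ 0 := normSq_eq_zero.not.mpr ha
  rw [div_im, div_im]
  field_simp
  rw [normSq_apply]
  ring

theorem integral_deriv_vertical_eq_zero {k k' : ℝ → ℝ} (hd : ∀ θ, HasDerivAt k (k' θ) θ)
    (hk' : Continuous k') (hper : k (2 * π) = k 0) : ∫ θ in (0 : ℝ)..2 * π, k' θ = 0 := by
  rw [intervalIntegral.integral_eq_sub_of_hasDerivAt (fun θ _ => hd θ)
    (hk'.intervalIntegrable _ _), hper, sub_self]

variable {T σ : ℝ} {f : ℂ → ℂ}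

theorem vertical_periodic {g : ℂ → ℂ} (h : Function.Periodic g (2 * π * I)) (t : ℝ) :
    g (t + (2 * π : ℝ) * I) = g (t + (0 : ℝ) * I) := by
  have := h (t + (0 : ℝ) * I)
  rw [← this]; congr 1; push_cast; ring

/-- Stokes' theorem for the pullback of φ(|w|²) d arg w. The y-derivative of its dx-component
integrates to zero by periodicity; subtracting it cancels the mixed second derivatives and leaves
the Jacobian. -/
theorem hasDerivAt_flux (hf : ContDiffOn ℝ ∞ f (strip T)) (hper : Function.Periodic f (2 * π * I))
    (h0 : ∀ z ∈ strip T, f z ≠ 0) {φ : ℝ → ℝ} (hφ : ContDiff ℝ 1 φ) {t : ℝ} (ht : t ∈ Ioo 0 T) :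
    HasDerivAt (fun s : ℝ => ∫ θ in (0 : ℝ)..2 * π, φ (normSq (f (s + θ * I))) *
        (dy f (s + θ * I) / f (s + θ * I)).im)
      (∫ θ in (0 : ℝ)..2 * π, deriv φ (normSq (f (t + θ * I))) *
        (2 * ((dx f (t + θ * I)).re * (dy f (t + θ * I)).im
          - (dx f (t + θ * I)).im * (dy f (t + θ * I)).re))) t := by
  have hx := contDiffOn_dx hf
  have hy := contDiffOn_dy hf
  have cf := hf.continuousOn
  have cx := hx.continuousOn
  have cy := hy.continuousOn
  have cxy := (contDiffOn_dx hy).continuousOn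
  have cyx := (contDiffOn_dy hx).continuousOn
  have cn : ContinuousOn (fun z => normSq (f z)) (strip T) := continuous_normSq.comp_continuousOn cf
  have cφ : ContinuousOn (fun z => φ (normSq (f z))) (strip T) := hφ.continuous.comp_continuousOn cn
  have cφ' : ContinuousOn (fun z => deriv φ (normSq (f z))) (strip T) :=
    (hφ.continuous_deriv le_rfl).comp_continuousOn cn
  have cre : ∀ {g : ℂ → ℂ}, ContinuousOn g (strip T) → ContinuousOn (fun z => (g z).re) (strip T) :=
    fun h => continuous_re.comp_continuousOn h
  have cim : ∀ {g : ℂ → ℂ}, ContinuousOn g (strip T) → ContinuousOn (fun z => (g z).im) (strip T) :=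
    fun h => continuous_im.comp_continuousOn h
  set g' : ℂ → ℝ := fun z => deriv φ (normSq (f z)) *
      (2 * ((f z).re * (dx f z).re + (f z).im * (dx f z).im)) * (dy f z / f z).im
      + φ (normSq (f z)) * ((dx (dy f) z * f z - dy f z * dx f z) / f z ^ 2).im with hg'
  set k' : ℂ → ℝ := fun z => deriv φ (normSq (f z)) *
      (2 * ((f z).re * (dy f z).re + (f z).im * (dy f z).im)) * (dx f z / f z).im
      + φ (normSq (f z)) * ((dy (dx f) z * f z - dx f z * dy f z) / f z ^ 2).im with hk'
  have h02 : ∀ z ∈ strip T, f z ^ 2 ≠ 0 := fun z hz => pow_ne_zero 2 (h0 z hz)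
  have cg' : ContinuousOn g' (strip T) :=
    ((cφ'.mul (((cre cf).mul (cre cx)).add ((cim cf).mul (cim cx)) |>.const_mul 2)).mul
      (cim (cy.div cf h0))).add (cφ.mul (cim (((cxy.mul cf).sub (cy.mul cx)).div (cf.pow 2) h02)))
  have ck' : ContinuousOn k' (strip T) :=
    ((cφ'.mul (((cre cf).mul (cre cy)).add ((cim cf).mul (cim cy)) |>.const_mul 2)).mul
      (cim (cx.div cf h0))).add (cφ.mul (cim (((cyx.mul cf).sub (cx.mul cy)).div (cf.pow 2) h02)))
  have hD := hasDerivAt_integral_vertical (g := fun z => φ (normSq (f z)) * (dy f z / f z).im)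
    (g' := g') (cφ.mul (cim (cy.div cf h0))) cg'
    (fun s hs θ => hasDerivAt_weighted_angle (hasDerivAt_dx hf hs θ) (hasDerivAt_dx hy hs θ)
      (h0 _ (add_mul_I_mem_strip hs θ)) hφ) ht
  have hK : ∫ θ in (0 : ℝ)..2 * π, k' (t + θ * I) = 0 := by
    refine integral_deriv_vertical_eq_zero
      (k := fun θ => φ (normSq (f (t + θ * I))) * (dx f (t + θ * I) / f (t + θ * I)).im)
      (fun θ => hasDerivAt_weighted_angle (hasDerivAt_dy hf ht θ) (hasDerivAt_dy hx ht θ)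
      (h0 _ (add_mul_I_mem_strip ht θ)) hφ) (continuous_vertical ck' ht) ?_
    simp only [vertical_periodic hper, vertical_periodic (dx_periodic hper)]
  refine hD.congr_deriv ?_
  have hS := intervalIntegral.integral_sub
    ((continuous_vertical cg' ht).intervalIntegrable (μ := volume) 0 (2 * π))
    ((continuous_vertical ck' ht).intervalIntegrable (μ := volume) 0 (2 * π))
  rw [hK, sub_zero] at hS
  rw [← hS]
  congr 1
  funext θ
  have hz := add_mul_I_mem_strip ht θ
  simp only [hg', hk']
  rw [← jacobian_identity (h0 _ hz), dx_dy_comm hf hz, mul_comm (dx f (t + θ * I)) (dy f _)]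
  ring

/-- If L is a primitive of F'/F, then exp(-L) F is constant, so periodicity of F puts the increment
of L in 2πiℤ. -/
theorem exists_int_winding {F F' : ℝ → ℂ} (hd : ∀ θ, HasDerivAt F (F' θ) θ) (hF' : Continuous F')
    (h0 : ∀ θ, F θ ≠ 0) (hper : F (2 * π) = F 0) :
    ∃ N : ℤ, ∫ θ in (0 : ℝ)..2 * π, (F' θ / F θ).im = 2 * π * N := by
  have hF : Continuous F := continuous_iff_continuousAt.mpr fun θ => (hd θ).continuousAt
  have hc : Continuous fun θ => F' θ / F θ := hF'.div hF h0
  have hD : ∀ θ : ℝ, HasDerivAt (fun s => cexp (-∫ x in (0 : ℝ)..s, F' x / F x) * F s) 0 θ := by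
    intro θ
    have h1 := (intervalIntegral.integral_hasDerivAt_right (hc.intervalIntegrable 0 θ)
      (hc.stronglyMeasurableAtFilter _ _) hc.continuousAt).neg.cexp.mul (hd θ)
    refine h1.congr_deriv ?_
    have := h0 θ
    field_simp
    ring
  have hconst := is_const_of_deriv_eq_zero (fun θ => (hD θ).differentiableAt)
    (fun θ => (hD θ).deriv) (2 * π) 0
  simp only [intervalIntegral.integral_same, neg_zero, Complex.exp_zero, one_mul, hper] at hconst
  have h1 : cexp (-∫ x in (0 : ℝ)..2 * π, F' x / F x) = 1 :=
    mul_right_cancel₀ (h0 0) (by rw [hconst, one_mul])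
  obtain ⟨n, hn⟩ := Complex.exp_eq_one_iff.mp h1
  refine ⟨-n, ?_⟩
  have h2 := imCLM.intervalIntegral_comp_comm (hc.intervalIntegrable (μ := volume) 0 (2 * π))
  simp only [imCLM_apply] at h2
  rw [h2, ← neg_neg (∫ x in (0 : ℝ)..2 * π, F' x / F x), hn]
  simp
  ring

end Flux

namespace IsHarmonicStripMap

variable {T σ : ℝ} {f : ℂ → ℂ}

theorem ne_zero (h : IsHarmonicStripMap T σ f) {z : ℂ} (hz : z ∈ strip T) : f z ≠ 0 :=
  norm_pos_iff.mp (zero_lt_one.trans (h.one_lt z hz))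

theorem continuous_angle (h : IsHarmonicStripMap T σ f) {t : ℝ} (ht : t ∈ Ioo 0 T) :
    Continuous fun θ : ℝ => (dy f (t + θ * I) / f (t + θ * I)).im :=
  continuous_im.comp ((continuous_vertical (contDiffOn_dy h.smooth).continuousOn ht).div
    (continuous_vertical h.smooth.continuousOn ht) fun θ => h.ne_zero (add_mul_I_mem_strip ht θ))

theorem flux_deriv_nonneg (h : IsHarmonicStripMap T σ f) {φ : ℝ → ℝ} (hm : Monotone φ)
    {t : ℝ} (ht : t ∈ Ioo 0 T) (θ : ℝ) :
    0 ≤ deriv φ (normSq (f (t + θ * I))) *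
        (2 * ((dx f (t + θ * I)).re * (dy f (t + θ * I)).im
          - (dx f (t + θ * I)).im * (dy f (t + θ * I)).re)) :=
  mul_nonneg hm.deriv_nonneg (by linarith [h.jac_pos _ (add_mul_I_mem_strip ht θ)])

theorem flux_monotoneOn (h : IsHarmonicStripMap T σ f) {φ : ℝ → ℝ} (hφ : ContDiff ℝ 1 φ)
    (hm : Monotone φ) :
    MonotoneOn (fun s : ℝ => ∫ θ in (0 : ℝ)..2 * π, φ (normSq (f (s + θ * I))) *
        (dy f (s + θ * I) / f (s + θ * I)).im) (Ioo 0 T) := by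
  have hD := fun t ht => hasDerivAt_flux h.smooth h.periodic (fun z hz => h.ne_zero hz) hφ (t := t) ht
  refine monotoneOn_of_deriv_nonneg (convex_Ioo 0 T)
    (fun t ht => (hD t ht).continuousAt.continuousWithinAt)
    (fun t ht => (hD t (interior_subset ht)).differentiableAt.differentiableWithinAt) ?_
  intro t ht
  rw [interior_Ioo] at ht
  rw [(hD t ht).deriv]
  exact intervalIntegral.integral_nonneg (by positivity) fun θ _ => h.flux_deriv_nonneg hm ht θ

theorem winding_const (h : IsHarmonicStripMap T σ f) {s t : ℝ} (hs : s ∈ Ioo 0 T)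
    (ht : t ∈ Ioo 0 T) :
    ∫ θ in (0 : ℝ)..2 * π, (dy f (s + θ * I) / f (s + θ * I)).im =
      ∫ θ in (0 : ℝ)..2 * π, (dy f (t + θ * I) / f (t + θ * I)).im := by
  -- Both constants 1 and -1 are monotone, so the winding integral is both increasing and
  -- decreasing.
  have h1 := h.flux_monotoneOn (φ := fun _ => 1) contDiff_const monotone_const
  have h2 := h.flux_monotoneOn (φ := fun _ => -1) contDiff_const monotone_const
  simp only [one_mul, neg_mul, intervalIntegral.integral_neg] at h1 h2
  rcases le_total s t with hst | hst
  · have := h1 hs ht hst; have := h2 hs ht hst; simp only at *; linarith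
  · have := h1 ht hs hst; have := h2 ht hs hst; simp only at *; linarith

/-- The winding is 2π times an integer, so positivity is enough. A cutoff φ vanishing near the inner
circle and equal to 1 near the outer one makes the flux rise from 0 to the winding; the rise is
strict because the Jacobian is positive where φ' > 0. -/
theorem two_pi_le_winding (h : IsHarmonicStripMap T σ f) (hσ : 1 < σ) {t : ℝ} (ht : t ∈ Ioo 0 T) :
    2 * π ≤ ∫ θ in (0 : ℝ)..2 * π, (dy f (t + θ * I) / f (t + θ * I)).im := by
  have hT : 0 < T := ht.1.trans ht.2
  obtain ⟨N, hN⟩ := exists_int_winding (hasDerivAt_dy h.smooth ht)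
    (continuous_vertical (contDiffOn_dy h.smooth).continuousOn ht)
    (fun θ => h.ne_zero (add_mul_I_mem_strip ht θ)) (vertical_periodic h.periodic t)
  rw [hN]
  suffices hpos : 0 < ∫ θ in (0 : ℝ)..2 * π, (dy f (t + θ * I) / f (t + θ * I)).im by
    rw [hN] at hpos
    have h1 : (0 : ℝ) < N := pos_of_mul_pos_right hpos (by positivity)
    have h2 : (1 : ℝ) ≤ N := by exact_mod_cast Int.cast_pos.mp h1
    nlinarith [Real.two_pi_pos]
  obtain ⟨a, ha1, haσ⟩ := exists_between hσ
  obtain ⟨b, hab, hbσ⟩ := exists_between haσ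
  have hab2 : a ^ 2 < b ^ 2 := by nlinarith
  set φ : ℝ → ℝ := fun s => Real.smoothTransition ((s - a ^ 2) / (b ^ 2 - a ^ 2)) with hφd
  have hφ : ContDiff ℝ 1 φ :=
    Real.smoothTransition.contDiff.comp ((contDiff_id.sub contDiff_const).div_const _)
  have hm : Monotone φ := fun x y hxy => Real.smoothTransition.monotone
    (div_le_div_of_nonneg_right (by linarith) (by linarith))
  obtain ⟨δ, hδ, hin⟩ := h.inner a ha1
  obtain ⟨ε, hε, hout⟩ := h.outer b hbσ
  have hφ0 : ∀ z ∈ strip T, z.re < δ → φ (normSq (f z)) = 0 := by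
    intro z hz hzr
    refine Real.smoothTransition.zero_of_nonpos (div_nonpos_of_nonpos_of_nonneg ?_ (by linarith))
    have := hin z hz hzr
    rw [normSq_eq_norm_sq]; nlinarith [norm_nonneg (f z)]
  have hφ1 : ∀ z ∈ strip T, T - ε < z.re → φ (normSq (f z)) = 1 := by
    intro z hz hzr
    refine Real.smoothTransition.one_of_one_le ?_
    have := hout z hz hzr
    rw [one_le_div (by linarith), normSq_eq_norm_sq]; nlinarith [norm_nonneg (f z)]
  obtain ⟨t₁, h10, h1⟩ := exists_between (lt_min hδ (half_pos hT))
  obtain ⟨t₂, h2, h2T⟩ := exists_between (max_lt (sub_lt_self T hε) (half_lt_self hT))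
  have ht12 : t₁ < t₂ := (h1.trans_le (min_le_right _ _)).trans ((le_max_right _ _).trans_lt h2)
  have ht1 : t₁ ∈ Ioo 0 T := ⟨h10, ht12.trans h2T⟩
  have ht2 : t₂ ∈ Ioo 0 T := ⟨h10.trans ht12, h2T⟩
  have hsub : Icc t₁ t₂ ⊆ Ioo 0 T := fun x hx => ⟨h10.trans_le hx.1, hx.2.trans_lt h2T⟩
  rw [h.winding_const ht ht2]
  set Φ : ℝ → ℝ := fun s : ℝ => ∫ θ in (0 : ℝ)..2 * π, φ (normSq (f (s + θ * I))) *
        (dy f (s + θ * I) / f (s + θ * I)).im with hΦ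
  have hΦ1 : Φ t₁ = 0 := by
    have : ∀ θ : ℝ, φ (normSq (f (t₁ + θ * I))) = 0 := fun θ =>
      hφ0 _ (add_mul_I_mem_strip ht1 θ) (by simpa using h1.trans_le (min_le_left _ _))
    simp [hΦ, this]
  have hΦ2 : Φ t₂ = ∫ θ in (0 : ℝ)..2 * π, (dy f (t₂ + θ * I) / f (t₂ + θ * I)).im := by
    have : ∀ θ : ℝ, φ (normSq (f (t₂ + θ * I))) = 1 := fun θ =>
      hφ1 _ (add_mul_I_mem_strip ht2 θ) (by simpa using (le_max_left _ _).trans_lt h2)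
    simp [hΦ, this]
  rw [← hΦ2]
  have hmono := h.flux_monotoneOn hφ hm
  refine lt_of_le_of_ne (hΦ1 ▸ hmono ht1 ht2 ht12.le) fun h0 => ?_
  have hzero : ∀ s ∈ Icc t₁ t₂, Φ s = 0 := fun s hs =>
    le_antisymm (h0 ▸ hmono (hsub hs) ht2 hs.2) (hΦ1 ▸ hmono ht1 (hsub hs) hs.1)
  -- along the real segment the truncated radius grows from `0` to `1`
  have hψ : ∀ s ∈ Ioo 0 T, DifferentiableAt ℝ (fun s : ℝ => φ (normSq (f (s + (0 : ℝ) * I)))) s := by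
    intro s hs
    have hF := (hasDerivAt_dx h.smooth hs 0).differentiableAt
    have h1 : DifferentiableAt ℝ (fun s : ℝ => normSq (f (s + (0 : ℝ) * I))) s := by
      have hre := reCLM.differentiableAt.comp s hF
      have him := imCLM.differentiableAt.comp s hF
      simp only [normSq_apply]
      exact (hre.mul hre).add (him.mul him)
    exact (hφ.differentiable (by simp) _).comp s h1
  obtain ⟨s, hs, hse⟩ := exists_deriv_eq_slope (fun s : ℝ => φ (normSq (f (s + (0 : ℝ) * I)))) ht12
    (fun s hs => (hψ s (hsub hs)).continuousAt.continuousWithinAt)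
    (fun s hs => (hψ s (hsub (Ioo_subset_Icc_self hs))).differentiableWithinAt)
  have hsT := hsub (Ioo_subset_Icc_self hs)
  rw [hφ1 _ (add_mul_I_mem_strip ht2 0) (by simpa using (le_max_left _ _).trans_lt h2),
    hφ0 _ (add_mul_I_mem_strip ht1 0) (by simpa using h1.trans_le (min_le_left _ _))] at hse
  have hφs : 0 < deriv φ (normSq (f (s + (0 : ℝ) * I))) := by
    refine lt_of_le_of_ne hm.deriv_nonneg fun h0 => ?_
    have hF := (hasDerivAt_dx h.smooth hsT 0)
    have hre : HasDerivAt (fun s : ℝ => (f (s + (0 : ℝ) * I)).re) _ s :=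
      reCLM.hasFDerivAt.comp_hasDerivAt s hF
    have him : HasDerivAt (fun s : ℝ => (f (s + (0 : ℝ) * I)).im) _ s :=
      imCLM.hasFDerivAt.comp_hasDerivAt s hF
    have hn := (hre.mul hre).add (him.mul him)
    have hc := HasDerivAt.comp s (h₂ := φ) (hφ.differentiable (by simp) _).hasDerivAt hn
    have hc' := hc.deriv
    rw [show ((fun s : ℝ => (f (s + (0 : ℝ) * I)).re) * (fun s : ℝ => (f (s + (0 : ℝ) * I)).re) +
      (fun s : ℝ => (f (s + (0 : ℝ) * I)).im) * (fun s : ℝ => (f (s + (0 : ℝ) * I)).im)) =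
      fun s : ℝ => normSq (f (s + (0 : ℝ) * I)) from rfl, ← h0, zero_mul] at hc'
    have : (0 : ℝ) < (1 - 0) / (t₂ - t₁) := by
      have : 0 < t₂ - t₁ := by linarith
      positivity
    rw [← hse] at this
    exact this.ne' hc'
  have hD := hasDerivAt_flux h.smooth h.periodic (fun z hz => h.ne_zero hz) hφ hsT
  have hD0 : HasDerivAt Φ 0 s :=
    (hasDerivAt_const s (0 : ℝ)).congr_of_eventuallyEq
      (by filter_upwards [Icc_mem_nhds hs.1 hs.2] with x hx using hzero x hx)
  have hI := hD.unique hD0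
  have hJ : 0 < ∫ θ in (0 : ℝ)..2 * π, deriv φ (normSq (f (s + θ * I))) *
        (2 * ((dx f (s + θ * I)).re * (dy f (s + θ * I)).im
          - (dx f (s + θ * I)).im * (dy f (s + θ * I)).re)) := by
    refine intervalIntegral.integral_pos Real.two_pi_pos ?_
      (fun θ _ => h.flux_deriv_nonneg hm hsT θ) ⟨0, ⟨le_rfl, Real.two_pi_pos.le⟩, ?_⟩
    · have cx := continuous_vertical (contDiffOn_dx h.smooth).continuousOn hsT
      have cy := continuous_vertical (contDiffOn_dy h.smooth).continuousOn hsT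
      have cf := continuous_vertical h.smooth.continuousOn hsT
      have cd := (hφ.continuous_deriv le_rfl).comp (continuous_normSq.comp cf)
      exact (cd.mul (continuous_const.mul (((continuous_re.comp cx).mul (continuous_im.comp cy)).sub
        ((continuous_im.comp cx).mul (continuous_re.comp cy))))).continuousOn
    · exact mul_pos hφs (by linarith [h.jac_pos _ (add_mul_I_mem_strip hsT 0)])
  exact hJ.ne' hI

/-- Morally the flux for φ(s) = s - 1, which vanishes at the inner edge and equals area integral
minus winding at t. Since the angular derivative is not controlled near the edge, φ is cut off to
vanish near s = 1. -/
theorem two_pi_le_area (h : IsHarmonicStripMap T σ f) (hσ : 1 < σ) {t : ℝ} (ht : t ∈ Ioo 0 T) :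
    2 * π ≤ ∫ θ in (0 : ℝ)..2 * π, ((f (t + θ * I)).re * (dy f (t + θ * I)).im
      - (f (t + θ * I)).im * (dy f (t + θ * I)).re) := by
  refine (h.two_pi_le_winding hσ ht).trans ?_
  have cf := continuous_vertical h.smooth.continuousOn ht
  obtain ⟨θ₀, -, hθ₀⟩ := isCompact_Icc.exists_isMinOn (nonempty_Icc.mpr Real.two_pi_pos.le)
    (continuous_normSq.comp cf).continuousOn
  set m := normSq (f (t + θ₀ * I)) with hm
  have hm1 : 1 < m := by
    have := h.one_lt _ (add_mul_I_mem_strip ht θ₀)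
    rw [hm, normSq_eq_norm_sq]; nlinarith
  obtain ⟨a, ha1, ham⟩ := exists_between hm1
  -- Zero for s ≤ a and equal to s - 1 for s ≥ m, the minimum of |f|² on the line at t.
  set φ : ℝ → ℝ := fun s => (s - 1) * Real.smoothTransition ((s - a) / (m - a)) with hφd
  have hφ : ContDiff ℝ 1 φ := (contDiff_id.sub contDiff_const).mul
    (Real.smoothTransition.contDiff.comp ((contDiff_id.sub contDiff_const).div_const _))
  have hφ0 : ∀ s ≤ a, φ s = 0 := fun s hs => by
    simp only [hφd]
    rw [Real.smoothTransition.zero_of_nonpos, mul_zero]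
    exact div_nonpos_of_nonpos_of_nonneg (by linarith) (by linarith)
  have hmon : Monotone φ := by
    intro x y hxy
    rcases le_total x a with hx | hx
    · rw [hφ0 x hx]
      rcases le_total y a with hy | hy
      · rw [hφ0 y hy]
      · exact mul_nonneg (by linarith) (Real.smoothTransition.nonneg _)
    · refine mul_le_mul (by linarith) (Real.smoothTransition.monotone
        (div_le_div_of_nonneg_right (by linarith) (by linarith)))
        (Real.smoothTransition.nonneg _) (by linarith)
  obtain ⟨δ, hδ, hin⟩ := h.inner (√a) (Real.lt_sqrt_of_sq_lt (by simpa using ha1))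
  obtain ⟨t₁, h10, h1⟩ := exists_between (lt_min hδ ht.1)
  have ht1t : t₁ < t := h1.trans_le (min_le_right _ _)
  have ht1 : t₁ ∈ Ioo 0 T := ⟨h10, ht1t.trans ht.2⟩
  have hle := h.flux_monotoneOn hφ hmon ht1 ht ht1t.le
  have hz : ∀ θ : ℝ, φ (normSq (f (t₁ + θ * I))) = 0 := fun θ => by
    refine hφ0 _ ?_
    have := hin _ (add_mul_I_mem_strip ht1 θ) (by simpa using h1.trans_le (min_le_left _ _))
    rw [normSq_eq_norm_sq]
    exact ((Real.lt_sqrt (norm_nonneg _)).mp this).le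
  simp only [hz, zero_mul, intervalIntegral.integral_zero] at hle
  have e : ∫ θ in (0 : ℝ)..2 * π, φ (normSq (f (t + θ * I))) * (dy f (t + θ * I) / f (t + θ * I)).im
      = ∫ θ in (0 : ℝ)..2 * π, (((f (t + θ * I)).re * (dy f (t + θ * I)).im
      - (f (t + θ * I)).im * (dy f (t + θ * I)).re) - (dy f (t + θ * I) / f (t + θ * I)).im) := by
    refine intervalIntegral.integral_congr fun θ hθ => ?_
    rw [uIcc_of_le Real.two_pi_pos.le] at hθ
    have hmθ : m ≤ normSq (f (t + θ * I)) := hθ₀ hθ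
    have h0 : normSq (f (t + θ * I)) ≠ 0 := by linarith
    simp only [hφd]
    rw [Real.smoothTransition.one_of_one_le (by rw [one_le_div (by linarith)]; linarith), div_im]
    field_simp
  rw [e, intervalIntegral.integral_sub] at hle
  · linarith
  · have cy := continuous_vertical (contDiffOn_dy h.smooth).continuousOn ht
    exact (((continuous_re.comp cf).mul (continuous_im.comp cy)).sub
        ((continuous_im.comp cf).mul (continuous_re.comp cy))).intervalIntegrable _ _
  · exact (h.continuous_angle ht).intervalIntegrable _ _

end IsHarmonicStripMap

/-! ### Growth of the quadratic mean and the Nitsche bound on the strip -/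

theorem modeSol_eq_of_hasDerivAt {T : ℝ} {n : ℤ} {y y' : ℝ → ℂ}
    (hy : ∀ t ∈ Ioo 0 T, HasDerivAt y (y' t) t)
    (hy' : ∀ t ∈ Ioo 0 T, HasDerivAt y' (n ^ 2 * y t) t) {t τ : ℝ} (ht : t ∈ Ioo 0 T)
    (hτ : 0 ≤ τ) (htτ : t + τ < T) : y (t + τ) = modeSol n (y t) (y' t) τ := by
  have hsub : ∀ s ∈ Icc t (t + τ), s ∈ Ioo 0 T := fun s hs =>
    ⟨ht.1.trans_le hs.1, hs.2.trans_lt htτ⟩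
  -- The value at t + τ predicted from the data at s; it does not depend on s, which gives
  -- uniqueness for the equation.
  obtain ⟨p, hp⟩ : ∃ p : ℝ → ℂ, p = fun s => modeSol n (y s) (y' s) (t + τ - s) := ⟨_, rfl⟩
  have hD : ∀ s ∈ Icc t (t + τ), HasDerivAt p 0 s := by
    intro s hs
    have h1 := hy s (hsub s hs)
    have h2 := hy' s (hsub s hs)
    have hl : HasDerivAt (fun s : ℝ => t + τ - s) (-1) s := (hasDerivAt_id s).const_sub _
    by_cases hn : n = 0
    · subst hn
      have : p = fun s => y s + ((t + τ - s : ℝ) : ℂ) * y' s := by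
        rw [hp]; funext x; simp [modeSol]
      rw [this]
      refine (h1.add (hl.ofReal_comp.mul h2)).congr_deriv ?_
      simp
    · have : p = fun s => (Real.cosh (n * (t + τ - s)) : ℝ) * y s
          + ((Real.sinh (n * (t + τ - s)) / n : ℝ) : ℂ) * y' s := by
        rw [hp]; funext x; simp [modeSol, hn]
      rw [this]
      have hnl := hl.const_mul (n : ℝ)
      refine ((hnl.cosh.ofReal_comp.mul h1).add
        ((hnl.sinh.div_const (n : ℝ)).ofReal_comp.mul h2)).congr_deriv ?_
      have : (n : ℂ) ≠ 0 := by exact_mod_cast hn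
      push_cast
      field_simp
      ring
  have hc := constant_of_has_deriv_right_zero (a := t) (b := t + τ)
    (fun s hs => (hD s hs).continuousAt.continuousWithinAt)
    (fun s hs => (hD s (Ico_subset_Icc_self hs)).hasDerivWithinAt) (t + τ) ⟨by linarith, le_rfl⟩
  rw [hp] at hc
  simp only [sub_self, add_sub_cancel_left] at hc
  rw [← hc]
  by_cases hn : n = 0 <;> simp [modeSol, hn]

namespace IsHarmonicStripMap

variable {T σ : ℝ} {f : ℂ → ℂ}

theorem hasDerivAt_fc {g : ℂ → ℂ} (hg : ContDiffOn ℝ ∞ g (strip T)) (n : ℤ) {t : ℝ}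
    (ht : t ∈ Ioo 0 T) :
    HasDerivAt (fun s : ℝ => fc (fun θ => g (s + θ * I)) n)
      (fc (fun θ => dx g (t + θ * I)) n) t := by
  have hc : Continuous fun z : ℂ => cexp (-(n * z.im * I)) := by fun_prop
  have h := hasDerivAt_integral_vertical (T := T)
    (g := fun z => cexp (-(n * z.im * I)) * g z) (g' := fun z => cexp (-(n * z.im * I)) * dx g z)
    (hc.continuousOn.mul hg.continuousOn) (hc.continuousOn.mul (contDiffOn_dx hg).continuousOn)
    (fun s hs θ => by simpa using (hasDerivAt_dx hg hs θ).const_mul (cexp (-(n * θ * I)))) ht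
  have e : ∀ s θ : ℝ, ((s : ℂ) + θ * I).im = θ := fun s θ => by simp
  simp only [e] at h
  exact h.const_smul ((2 * π : ℝ)⁻¹)

theorem fc_dy {g : ℂ → ℂ} (hg : ContDiffOn ℝ ∞ g (strip T))
    (hper : Function.Periodic g (2 * π * I)) (n : ℤ) {t : ℝ} (ht : t ∈ Ioo 0 T) :
    fc (fun θ => dy g (t + θ * I)) n = n * I * fc (fun θ => g (t + θ * I)) n :=
  fc_deriv (hasDerivAt_dy hg ht) (continuous_vertical (contDiffOn_dy hg).continuousOn ht)
    (vertical_periodic hper t) n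

theorem hasDerivAt_fc_dx (h : IsHarmonicStripMap T σ f) (n : ℤ) {t : ℝ} (ht : t ∈ Ioo 0 T) :
    HasDerivAt (fun s : ℝ => fc (fun θ => dx f (s + θ * I)) n)
      (n ^ 2 * fc (fun θ => f (t + θ * I)) n) t := by
  refine (hasDerivAt_fc (contDiffOn_dx h.smooth) n ht).congr_deriv ?_
  have e : (fun θ : ℝ => dx (dx f) (t + θ * I)) = fun θ : ℝ => -dy (dy f) (t + θ * I) :=
    funext fun θ => eq_neg_of_add_eq_zero_left (h.laplace _ (add_mul_I_mem_strip ht θ))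
  have e2 : fc (fun θ : ℝ => -dy (dy f) (t + θ * I)) n = -fc (fun θ : ℝ => dy (dy f) (t + θ * I)) n := by
    simp [fc]
  rw [e, e2, fc_dy (contDiffOn_dy h.smooth) (dy_periodic h.periodic) n ht,
    fc_dy h.smooth h.periodic n ht]
  linear_combination -(n : ℂ) ^ 2 * fc (fun θ => f (t + θ * I)) n * I_sq

/-- The mean of `‖f‖²` over the vertical segment of abscissa `t`. -/
noncomputable def mean (f : ℂ → ℂ) (t : ℝ) : ℝ :=
  (2 * π)⁻¹ * ∫ θ in (0 : ℝ)..2 * π, ‖f (t + θ * I)‖ ^ 2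

theorem mean_le {a t : ℝ} (hf : Continuous fun θ : ℝ => f (t + θ * I))
    (ha : ∀ θ : ℝ, ‖f (t + θ * I)‖ ^ 2 ≤ a) : mean f t ≤ a := by
  have h := intervalIntegral.integral_mono_on (a := 0) (b := 2 * π) Real.two_pi_pos.le
    ((hf.norm.pow 2).intervalIntegrable (μ := volume) _ _)
    (continuous_const (y := a).intervalIntegrable _ _) (fun θ _ => ha θ)
  rw [intervalIntegral.integral_const, sub_zero, smul_eq_mul] at h
  rw [mean, inv_mul_le_iff₀ Real.two_pi_pos]
  exact h

theorem le_mean {a t : ℝ} (hf : Continuous fun θ : ℝ => f (t + θ * I))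
    (ha : ∀ θ : ℝ, a < ‖f (t + θ * I)‖ ^ 2) : a < mean f t := by
  have h := intervalIntegral.integral_lt_integral_of_continuousOn_of_le_of_exists_lt
    (a := 0) (b := 2 * π) Real.two_pi_pos (continuousOn_const (c := a))
    ((hf.norm.pow 2).continuousOn)
    (fun θ _ => (ha θ).le) ⟨0, ⟨le_rfl, Real.two_pi_pos.le⟩, ha 0⟩
  rw [intervalIntegral.integral_const, sub_zero, smul_eq_mul] at h
  rw [mean, lt_inv_mul_iff₀ Real.two_pi_pos]
  exact h

theorem hasDerivAt_mean (h : IsHarmonicStripMap T σ f) {t : ℝ} (ht : t ∈ Ioo 0 T) :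
    HasDerivAt (mean f) (2 * ((2 * π)⁻¹ * ∫ θ in (0 : ℝ)..2 * π,
      ((f (t + θ * I)).re * (dx f (t + θ * I)).re + (f (t + θ * I)).im * (dx f (t + θ * I)).im))) t := by
  have cf := h.smooth.continuousOn
  have cx := (contDiffOn_dx h.smooth).continuousOn
  have h1 := hasDerivAt_integral_vertical (T := T) (g := fun z => ‖f z‖ ^ 2)
    (g' := fun z => 2 * ((f z).re * (dx f z).re + (f z).im * (dx f z).im))
    (cf.norm.pow 2)
    (continuousOn_const.mul (((continuous_re.comp_continuousOn cf).mul
      (continuous_re.comp_continuousOn cx)).add ((continuous_im.comp_continuousOn cf).mul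
      (continuous_im.comp_continuousOn cx)))) ?_ ht
  · refine (h1.const_mul (2 * π)⁻¹).congr_deriv ?_
    rw [intervalIntegral.integral_const_mul]; ring
  · intro s hs θ
    have hF := hasDerivAt_dx h.smooth hs θ
    have hre : HasDerivAt (fun s : ℝ => (f (s + θ * I)).re) _ s :=
      reCLM.hasFDerivAt.comp_hasDerivAt s hF
    have him : HasDerivAt (fun s : ℝ => (f (s + θ * I)).im) _ s :=
      imCLM.hasFDerivAt.comp_hasDerivAt s hF
    simp only [← normSq_eq_norm_sq, normSq_apply]
    refine ((hre.mul hre).add (him.mul him)).congr_deriv ?_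
    simp only [reCLM_apply, imCLM_apply]
    ring

theorem mean_growth (h : IsHarmonicStripMap T σ f) (hσ : 1 < σ) {τ μ : ℝ} (hτ : 0 < τ)
    (hμ0 : 0 ≤ μ)
    (hμ : ∀ (n : ℤ) (α β : ℂ),
      (Real.cosh τ ^ 2 - μ) * ‖α‖ ^ 2 + μ * (n * ‖α‖ ^ 2)
        + 2 * (Real.sinh τ * Real.cosh τ) * (α.re * β.re + α.im * β.im) ≤ ‖modeSol n α β τ‖ ^ 2)
    {t : ℝ} (ht : t ∈ Ioo 0 T) (htτ : t + τ < T) (hd : 0 ≤ deriv (mean f) t) :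
    (Real.cosh τ ^ 2 - μ) * mean f t + μ ≤ mean f (t + τ) := by
  have hs : t + τ ∈ Ioo 0 T := ⟨add_pos ht.1 hτ, htτ⟩
  have cf := continuous_vertical h.smooth.continuousOn ht
  have cx := continuous_vertical (contDiffOn_dx h.smooth).continuousOn ht
  have cy := continuous_vertical (contDiffOn_dy h.smooth).continuousOn ht
  have hU := hasSum_norm_fc_sq cf
  have hU2 := hasSum_norm_fc_sq (continuous_vertical h.smooth.continuousOn hs)
  have hX := hasSum_inner_fc cf cx
  have hA := hasSum_inner_fc cf (cy.const_mul (-I))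
  -- The operator -i ∂/∂y multiplies the n-th coefficient by n, so the area mean equals ∑ n |c_n|².
  have eA : ∀ n : ℤ, (fc (fun θ => f (t + θ * I)) n).re * (fc (fun θ => -I * dy f (t + θ * I)) n).re +
      (fc (fun θ => f (t + θ * I)) n).im * (fc (fun θ => -I * dy f (t + θ * I)) n).im =
      n * ‖fc (fun θ => f (t + θ * I)) n‖ ^ 2 := by
    intro n
    have e : fc (fun θ => -I * dy f (t + θ * I)) n = -I * fc (fun θ => dy f (t + θ * I)) n := by
      simp only [fc, Complex.real_smul]
      rw [show (fun θ : ℝ => cexp (-(n * θ * I)) * (-I * dy f (t + θ * I))) =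
        fun θ : ℝ => -I * (cexp (-(n * θ * I)) * dy f (t + θ * I)) from funext fun θ => by ring,
        intervalIntegral.integral_const_mul]
      ring
    have e2 : -I * (n * I * fc (fun θ => f (t + θ * I)) n) = n * fc (fun θ => f (t + θ * I)) n := by
      linear_combination -(n : ℂ) * fc (fun θ => f (t + θ * I)) n * I_sq
    rw [e, fc_dy h.smooth h.periodic n ht, e2, ← normSq_eq_norm_sq, normSq_apply]
    simp
    ring
  simp only [eA] at hA
  have hA1 : 1 ≤ (2 * π)⁻¹ * ∫ θ in (0 : ℝ)..2 * π, ((f (t + θ * I)).re * (-I * dy f (t + θ * I)).re +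
      (f (t + θ * I)).im * (-I * dy f (t + θ * I)).im) := by
    rw [le_inv_mul_iff₀ Real.two_pi_pos, mul_one]
    refine (h.two_pi_le_area hσ ht).trans_eq (intervalIntegral.integral_congr fun θ _ => ?_)
    simp
    ring
  have hmode : ∀ n : ℤ, fc (fun θ => f ((t + τ : ℝ) + θ * I)) n = modeSol n
      (fc (fun θ => f (t + θ * I)) n) (fc (fun θ => dx f (t + θ * I)) n) τ := fun n =>
    modeSol_eq_of_hasDerivAt (T := T) (y := fun s : ℝ => fc (fun θ => f (s + θ * I)) n)
      (y' := fun s : ℝ => fc (fun θ => dx f (s + θ * I)) n)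
      (fun s hs => hasDerivAt_fc h.smooth n hs) (fun s hs => h.hasDerivAt_fc_dx n hs) ht hτ.le htτ
  have hle := hasSum_le (fun n => (hμ n (fc (fun θ => f (t + θ * I)) n)
      (fc (fun θ => dx f (t + θ * I)) n)).trans_eq (by rw [hmode n]))
    (((hU.mul_left (Real.cosh τ ^ 2 - μ)).add (hA.mul_left μ)).add
      (hX.mul_left (2 * (Real.sinh τ * Real.cosh τ)))) hU2
  have hd' := hd
  rw [(h.hasDerivAt_mean ht).deriv] at hd'
  have hw : 0 ≤ Real.sinh τ * Real.cosh τ :=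
    mul_nonneg (Real.sinh_nonneg_iff.mpr hτ.le) (Real.cosh_pos τ).le
  have h1 := mul_le_mul_of_nonneg_left hA1 hμ0
  have h2 := mul_nonneg hw hd'
  simp only [mean]
  linarith

/-- The mean exceeds 1 and tends to 1 at the left edge, so it is smaller at some t₂ < t₁; the mean
value theorem gives a point of nonnegative derivative between them. -/
theorem exists_mean_deriv_nonneg (h : IsHarmonicStripMap T σ f) (hT : 0 < T) {a ε : ℝ} (ha : 1 < a)
    (hε : 0 < ε) : ∃ t ∈ Ioo 0 T, t < ε ∧ 0 ≤ deriv (mean f) t ∧ 1 < mean f t ∧ mean f t < a := by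
  have hc : ∀ t ∈ Ioo 0 T, Continuous fun θ : ℝ => f (t + θ * I) := fun t ht =>
    continuous_vertical h.smooth.continuousOn ht
  have hgt : ∀ t ∈ Ioo 0 T, 1 < mean f t := fun t ht =>
    le_mean (hc t ht) fun θ => by
      have := h.one_lt _ (add_mul_I_mem_strip ht θ); nlinarith
  have hlt : ∀ a, 1 < a → ∃ δ, 0 < δ ∧ ∀ t ∈ Ioo 0 T, t < δ → mean f t < a := by
    intro a ha
    obtain ⟨b, hb1, hba⟩ := exists_between ha
    obtain ⟨δ, hδ, hin⟩ := h.inner (√b) (Real.lt_sqrt_of_sq_lt (by simpa using hb1))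
    refine ⟨δ, hδ, fun t ht htδ => lt_of_le_of_lt (mean_le (hc t ht) fun θ => ?_) hba⟩
    exact ((Real.lt_sqrt (norm_nonneg _)).mp
      (hin _ (add_mul_I_mem_strip ht θ) (by simpa using htδ))).le
  obtain ⟨δ, hδ, h1⟩ := hlt a ha
  obtain ⟨t₁, h10, ht1⟩ := exists_between (lt_min (lt_min hδ hε) hT)
  have ht1T : t₁ ∈ Ioo 0 T := ⟨h10, ht1.trans_le (min_le_right _ _)⟩
  obtain ⟨δ', hδ', h2⟩ := hlt (mean f t₁) (hgt t₁ ht1T)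
  obtain ⟨t₂, h20, ht2⟩ := exists_between (lt_min hδ' h10)
  have ht21 : t₂ < t₁ := ht2.trans_le (min_le_right _ _)
  have ht2T : t₂ ∈ Ioo 0 T := ⟨h20, ht21.trans ht1T.2⟩
  have hsub : Icc t₂ t₁ ⊆ Ioo 0 T := fun x hx => ⟨h20.trans_le hx.1, hx.2.trans_lt ht1T.2⟩
  obtain ⟨s, hs, hse⟩ := exists_deriv_eq_slope (mean f) ht21
    (fun s hs => (h.hasDerivAt_mean (hsub hs)).continuousAt.continuousWithinAt)
    (fun s hs => (h.hasDerivAt_mean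
      (hsub (Ioo_subset_Icc_self hs))).differentiableAt.differentiableWithinAt)
  have hsT := hsub (Ioo_subset_Icc_self hs)
  have hs1 : s < min δ ε := hs.2.trans (ht1.trans_le (min_le_left _ _))
  refine ⟨s, hsT, hs1.trans_le (min_le_right _ _), ?_, hgt s hsT,
    h1 s hsT (hs1.trans_le (min_le_left _ _))⟩
  rw [hse]
  exact div_nonneg (by linarith [h2 t₂ ht2T (ht2.trans_le (min_le_left _ _))]) (by linarith)

/-- The Nitsche bound for harmonic strip maps. -/
theorem cosh_le (h : IsHarmonicStripMap T σ f) (hσ : 1 < σ) (hT : 0 < T) (hT' : T ≤ 3 / 2) :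
    Real.cosh T ≤ σ := by
  have hlt : ∀ τ ∈ Ioo 0 T, Real.cosh τ ≤ σ := by
    intro τ hτ
    obtain ⟨μ, hμ0, hμ⟩ := exists_mode_bound hτ.1 (hτ.2.le.trans hT')
    set l := Real.cosh τ ^ 2 - μ with hl
    have key : ∀ a, 1 < a → Real.cosh τ ^ 2 - |l| * (a - 1) ≤ σ ^ 2 := by
      intro a ha
      obtain ⟨t, ht, htε, hd, h1, h2⟩ := h.exists_mean_deriv_nonneg hT ha (sub_pos.mpr hτ.2)
      have hs : t + τ ∈ Ioo 0 T := ⟨add_pos ht.1 hτ.1, by linarith⟩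
      have hg := h.mean_growth hσ hτ.1 hμ0 hμ ht hs.2 hd
      have hσ2 : mean f (t + τ) ≤ σ ^ 2 :=
        mean_le (continuous_vertical h.smooth.continuousOn hs) fun θ => by
          have := (h.lt _ (add_mul_I_mem_strip hs θ)).le
          gcongr
      -- The coefficient l = cosh² τ - μ may be negative, hence the absolute value; the error
      -- vanishes as a → 1.
      have h3 : -(|l| * (a - 1)) ≤ l * (mean f t - 1) := by
        have h4 : |l * (mean f t - 1)| ≤ |l| * (a - 1) := by
          rw [abs_mul, abs_of_pos (by linarith : 0 < mean f t - 1)]; gcongr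
        exact (abs_le.mp h4).1
      rw [← hl] at hg
      linarith
    have hsq : Real.cosh τ ^ 2 ≤ σ ^ 2 := by
      refine le_of_forall_pos_le_add fun ε hε => ?_
      have h1 := key (1 + ε / (|l| + 1)) (by linarith [div_pos hε (by positivity : 0 < |l| + 1)])
      have h2 : |l| * (1 + ε / (|l| + 1) - 1) ≤ ε := by
        rw [add_sub_cancel_left, ← mul_div_assoc, div_le_iff₀ (by positivity)]
        nlinarith [abs_nonneg l]
      linarith
    exact le_of_sq_le_sq hsq (by linarith)
  have hc : ContinuousWithinAt Real.cosh (Iio T) T := Real.continuous_cosh.continuousWithinAt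
  refine le_of_tendsto hc ?_
  filter_upwards [Ioo_mem_nhdsLT hT] with τ hτ using hlt τ hτ

end IsHarmonicStripMap

/-! ### Lewy's theorem -/

/-- Three arcs issuing from a common point and otherwise disjoint do not embed in the line. -/
theorem tripod_not_embedded {w : Fin 3 → ℝ → ℝ} {ε c : ℝ} (hε : 0 < ε)
    (hw : ∀ k, ContinuousOn (w k) (Icc 0 ε)) (h0 : ∀ k, w k 0 = c)
    (hinj : ∀ k j, ∀ s ∈ Ioc 0 ε, ∀ s' ∈ Icc 0 ε, w k s = w j s' → k = j) : False := by
  have hmem : ε ∈ Ioc 0 ε := ⟨hε, le_rfl⟩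
  have hivt : ∀ k j, w k ε ∈ uIcc c (w j ε) → k = j := by
    intro k j hk
    have h := intermediate_value_uIcc (a := 0) (b := ε) (f := w j) (by rw [uIcc_of_le hε.le]; exact hw j)
    rw [h0, uIcc_of_le hε.le] at h
    obtain ⟨s, hs, hse⟩ := h hk
    exact hinj k j ε hmem s hs hse.symm
  have hsame : ∀ k j, (c < w k ε ↔ c < w j ε) → k = j := by
    intro k j hkj
    simp only [mem_uIcc] at hivt
    by_cases hk : c < w k ε
    · have hj := hkj.mp hk
      rcases le_total (w k ε) (w j ε) with h | h
      · exact hivt k j (Or.inl ⟨hk.le, h⟩)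
      · exact (hivt j k (Or.inl ⟨hj.le, h⟩)).symm
    · have hj : ¬ c < w j ε := fun h => hk (hkj.mpr h)
      rw [not_lt] at hk hj
      rcases le_total (w k ε) (w j ε) with h | h
      · exact (hivt j k (Or.inr ⟨h, hj⟩)).symm
      · exact hivt k j (Or.inr ⟨h, hk⟩)
  by_cases h01 : c < w 0 ε ↔ c < w 1 ε
  · exact absurd (hsame 0 1 h01) (by decide)
  · by_cases h02 : c < w 0 ε ↔ c < w 2 ε
    · exact absurd (hsame 0 2 h02) (by decide)
    · exact absurd (hsame 1 2 (by tauto)) (by decide)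

/-- In the coordinate ζ the level set of u contains the 2n ≥ 4 rays Re ζⁿ = 0. On it v alone must be
injective, so three of the rays would embed in the line. -/
theorem level_set_not_branched {u v : ℂ → ℝ} {z₀ : ℂ} {U V : Set ℂ} (hU : U ∈ 𝓝 z₀)
    (hv : ContinuousOn v U) (hinj : InjOn (fun z => (u z, v z)) U) {ψ : ℂ → ℂ} (hV : V ∈ 𝓝 0)
    (hψ : ContinuousOn ψ V) (hψi : InjOn ψ V) (hψ0 : ψ 0 = z₀) {n : ℕ} (hn : 2 ≤ n)
    (hlev : ∀ ζ ∈ V, (ζ ^ n).re = 0 → u (ψ ζ) = u z₀) : False := by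
  have hc : ContinuousAt ψ 0 := hψ.continuousAt hV
  have hVU : V ∩ ψ ⁻¹' U ∈ 𝓝 (0 : ℂ) := inter_mem hV (hc (by rwa [hψ0]))
  obtain ⟨r, hr, hball⟩ := Metric.mem_nhds_iff.mp hVU
  have hn0 : (n : ℂ) ≠ 0 := by exact_mod_cast (by omega : n ≠ 0)
  -- Directions whose n-th powers are ±i; they are distinct because 2n > 2.
  obtain ⟨ξ, hξ⟩ : ∃ ξ : Fin 3 → ℂ, ξ = fun k => cexp (((π * (1 / 2 + k.val) / n : ℝ) : ℂ) * I) :=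
    ⟨_, rfl⟩
  have hξn : ∀ k, ‖ξ k‖ = 1 := fun k => by rw [hξ]; exact norm_exp_ofReal_mul_I _
  have hξre : ∀ k, ((ξ k) ^ n).re = 0 := by
    intro k
    rw [hξ]
    simp only
    rw [← Complex.exp_nat_mul, show (n : ℂ) * (((π * (1 / 2 + k.val) / n : ℝ) : ℂ) * I) =
      ((π / 2 + k.val * π : ℝ) : ℂ) * I by push_cast; field_simp, exp_ofReal_mul_I_re,
      Real.cos_add_nat_mul_pi, Real.cos_pi_div_two, mul_zero]
  have hξinj : Function.Injective ξ := by
    intro k j hkj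
    rw [hξ] at hkj
    obtain ⟨m, hm⟩ := Complex.exp_eq_exp_iff_exists_int.mp hkj
    have hπ : (π : ℂ) ≠ 0 := by exact_mod_cast Real.pi_ne_zero
    have h1 : (k.val : ℂ) = j.val + 2 * m * n := by
      push_cast at hm
      have : (π : ℂ) * I ≠ 0 := mul_ne_zero hπ I_ne_zero
      apply mul_left_cancel₀ this
      field_simp at hm
      linear_combination hm * ((π : ℂ) * I) / 2
    have h2 : (k.val : ℤ) = j.val + 2 * m * n := by exact_mod_cast h1
    have hk := k.isLt
    have hj := j.isLt
    have hm0 : m = 0 := by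
      by_contra hne
      rcases lt_or_gt_of_ne hne with h | h
      · have : m * n ≤ -1 * n := by gcongr; omega
        nlinarith
      · have : 1 * (n : ℤ) ≤ m * n := by gcongr; omega
        nlinarith
    rw [hm0] at h2
    exact Fin.ext (by simpa using h2)
  have hray : ∀ k, ∀ s ∈ Icc 0 (r / 2), (s : ℂ) * ξ k ∈ V ∩ ψ ⁻¹' U := by
    intro k s hs
    apply hball
    rw [mem_ball_zero_iff, norm_mul, hξn, mul_one, norm_real, Real.norm_of_nonneg hs.1]
    linarith [hs.2]
  refine tripod_not_embedded (w := fun k s => v (ψ (s * ξ k))) (ε := r / 2) (c := v z₀) (by linarith)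
    (fun k => ?_) (fun k => by simp [hψ0]) ?_
  · exact hv.comp (hψ.comp (by fun_prop) fun s hs => (hray k s hs).1) fun s hs => (hray k s hs).2
  · intro k j s hs s' hs' heq
    have hk := hray k s (Ioc_subset_Icc_self hs)
    have hj := hray j s' hs'
    have hu : ∀ k (s : ℝ), s ∈ Icc 0 (r / 2) → u (ψ (s * ξ k)) = u z₀ := by
      intro k s hs
      refine hlev _ (hray k s hs).1 ?_
      rw [mul_pow, ← ofReal_pow, re_ofReal_mul, hξre, mul_zero]
    have h1 := hψi hk.1 hj.1 (hinj hk.2 hj.2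
      (Prod.ext ((hu k s (Ioc_subset_Icc_self hs)).trans (hu j s' hs').symm) heq))
    have h2 : s = s' := by
      have := congrArg norm h1
      rwa [norm_mul, norm_mul, hξn, hξn, mul_one, mul_one, norm_real, norm_real,
        Real.norm_of_nonneg hs.1.le, Real.norm_of_nonneg hs'.1] at this
    subst h2
    exact hξinj (mul_left_cancel₀ (by exact_mod_cast hs.1.ne') h1)

theorem exists_local_root {g : ℂ → ℂ} {z₀ : ℂ} (hg : AnalyticAt ℂ g z₀) (hg0 : g z₀ ≠ 0) {n : ℕ}
    (hn : n ≠ 0) : ∃ k : ℂ → ℂ, AnalyticAt ℂ k z₀ ∧ k z₀ ≠ 0 ∧ ∀ᶠ z in 𝓝 z₀, k z ^ n = g z := by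
  obtain ⟨b, hb⟩ := IsAlgClosed.exists_pow_nat_eq (g z₀) (Nat.pos_of_ne_zero hn)
  have hb0 : b ≠ 0 := fun h => hg0 (by rw [← hb, h, zero_pow hn])
  have hq : AnalyticAt ℂ (fun z => g z / g z₀) z₀ := hg.div analyticAt_const hg0
  have hl : AnalyticAt ℂ (fun z => Complex.log (g z / g z₀)) z₀ :=
    hq.clog (by rw [div_self hg0]; exact one_mem_slitPlane)
  refine ⟨fun z => b * cexp (Complex.log (g z / g z₀) / n),
    analyticAt_const.mul (hl.div analyticAt_const (by exact_mod_cast hn)).cexp,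
    mul_ne_zero hb0 (Complex.exp_ne_zero _), ?_⟩
  filter_upwards [hg.continuousAt.eventually_ne hg0] with z hz
  have hn' : (n : ℂ) ≠ 0 := by exact_mod_cast hn
  rw [mul_pow, hb, ← Complex.exp_nat_mul, mul_div_cancel₀ _ hn',
    Complex.exp_log (div_ne_zero hz hg0), mul_div_cancel₀ _ hg0]

/-- If a harmonic function is one coordinate of an injective continuous map of a neighbourhood of
`z₀` into the plane, then `z₀` is not one of its critical points. -/
theorem fderiv_ne_zero_of_injOn {u v : ℂ → ℝ} {z₀ : ℂ} {U : Set ℂ} (hU : U ∈ 𝓝 z₀)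
    (hu : HarmonicAt u z₀) (hv : ContinuousOn v U) (hinj : InjOn (fun z => (u z, v z)) U) :
    fderiv ℝ u z₀ ≠ 0 := by
  intro hcrit
  obtain ⟨R, hR, hRsub⟩ := Metric.isOpen_iff.mp (isOpen_setOfPred_harmonicAt u) z₀ hu
  obtain ⟨F, hF, hFu⟩ := HarmonicOnNhd.exists_analyticOnNhd_ball_re_eq fun y hy => hRsub hy
  have hFan := hF z₀ (Metric.mem_ball_self hR)
  have hFu' : ∀ᶠ z in 𝓝 z₀, (F z).re = u z :=
    eventually_of_mem (Metric.ball_mem_nhds z₀ hR) hFu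
  have hd : HasDerivAt F 0 z₀ := by
    have h1 := hFan.differentiableAt.hasDerivAt
    have h2 : HasFDerivAt u (reCLM.comp
        ((ContinuousLinearMap.toSpanSingleton ℂ (deriv F z₀)).restrictScalars ℝ)) z₀ :=
      (reCLM.hasFDerivAt.comp z₀ (h1.hasFDerivAt.restrictScalars ℝ)).congr_of_eventuallyEq
        (hFu'.mono fun z hz => hz.symm)
    rw [h2.fderiv] at hcrit
    have e1 := DFunLike.congr_fun hcrit 1
    have e2 := DFunLike.congr_fun hcrit I
    simp at e1 e2
    rwa [show deriv F z₀ = 0 from Complex.ext e1 e2] at h1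
  have hG : AnalyticAt ℂ (fun z => F z - F z₀) z₀ := hFan.sub analyticAt_const
  -- If F is locally constant, every ray lies in the level set. Otherwise F - F z₀ = ((z - z₀) k
  -- z)ⁿ, with n ≥ 2 by criticality, and (z - z₀) k z is the branching coordinate.
  by_cases hzero : ∀ᶠ z in 𝓝 z₀, F z - F z₀ = 0
  · have hc : ∀ᶠ ζ in 𝓝 (0 : ℂ), F (z₀ + ζ) - F z₀ = 0 ∧ (F (z₀ + ζ)).re = u (z₀ + ζ) := by
      have ht : Tendsto (fun ζ : ℂ => z₀ + ζ) (𝓝 0) (𝓝 z₀) :=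
        Continuous.tendsto' (by fun_prop) _ _ (add_zero z₀)
      exact ht.eventually (hzero.and hFu')
    refine level_set_not_branched (ψ := fun ζ => z₀ + ζ) hU hv hinj hc (by fun_prop)
      (fun _ _ _ _ h => add_left_cancel h) (add_zero z₀) le_rfl fun ζ hζ _ => ?_
    rw [← hζ.2, sub_eq_zero.mp hζ.1, hFu'.self_of_nhds]
  · obtain ⟨n, g, hg, hg0, hgF⟩ := hG.exists_eventuallyEq_pow_smul_nonzero_iff.mpr hzero
    have hn : 2 ≤ n := by
      by_contra hlt
      obtain rfl | rfl : n = 0 ∨ n = 1 := by omega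
      · have := hgF.self_of_nhds
        simp at this
        exact hg0 this.symm
      · have h1 : HasDerivAt (fun z => (z - z₀) ^ 1 • g z) (g z₀) z₀ := by
          simpa using ((hasDerivAt_id z₀).sub_const z₀).fun_mul hg.differentiableAt.hasDerivAt
        exact hg0 ((h1.congr_of_eventuallyEq hgF).unique (hd.sub_const _))
    obtain ⟨k, hk, hk0, hkg⟩ := exists_local_root hg hg0 (by omega : n ≠ 0)
    have hφ : AnalyticAt ℂ (fun z => (z - z₀) * k z) z₀ :=
      (analyticAt_id.sub analyticAt_const).mul hk
    have hφd : HasDerivAt (fun z => (z - z₀) * k z) (k z₀) z₀ := by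
      simpa using ((hasDerivAt_id z₀).sub_const z₀).fun_mul hk.differentiableAt.hasDerivAt
    have hs : HasStrictDerivAt (fun z => (z - z₀) * k z) (k z₀) z₀ := by
      have := hφ.hasStrictDerivAt
      rwa [hφd.deriv] at this
    have hse := hs.hasStrictFDerivAt_equiv hk0
    set e := hse.toOpenPartialHomeomorph (fun z => (z - z₀) * k z) with he
    have hcoe : ∀ z, e z = (z - z₀) * k z := fun z => rfl
    have hz0 : z₀ ∈ e.source := hse.mem_toOpenPartialHomeomorph_source
    have he0 : e z₀ = 0 := by rw [hcoe, sub_self, zero_mul]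
    have h0t : (0 : ℂ) ∈ e.target := he0 ▸ e.map_source hz0
    have hs0 : e.symm 0 = z₀ := by rw [← he0, e.left_inv hz0]
    have hW : ∀ᶠ z in 𝓝 z₀, (F z).re = u z ∧ F z - F z₀ = ((z - z₀) * k z) ^ n := by
      filter_upwards [hFu', hgF, hkg] with z h1 h2 h3
      exact ⟨h1, by rw [h2, mul_pow, h3, smul_eq_mul]⟩
    have hV : ∀ᶠ ζ in 𝓝 (0 : ℂ), ζ ∈ e.target ∧ ((F (e.symm ζ)).re = u (e.symm ζ) ∧
        F (e.symm ζ) - F z₀ = ((e.symm ζ - z₀) * k (e.symm ζ)) ^ n) := by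
      refine Filter.Eventually.and (e.open_target.mem_nhds h0t) ?_
      have hc := e.continuousAt_symm h0t
      rw [ContinuousAt, hs0] at hc
      exact hc.eventually hW
    refine level_set_not_branched (ψ := e.symm) hU hv hinj hV
      (e.continuousOn_symm.mono fun ζ hζ => hζ.1)
      (e.symm.injOn.mono fun ζ hζ => hζ.1) hs0 hn fun ζ hζ hre => ?_
    obtain ⟨ht, h1, h2⟩ := hζ
    rw [← hcoe, e.right_inv ht] at h2
    rw [← h1, ← hFu'.self_of_nhds, ← sub_eq_zero, ← sub_re, h2, hre]

/-- **Lewy's theorem**: the Jacobian of an injective harmonic map does not vanish. -/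
theorem jacobian_ne_zero_of_injOn {f : ℂ → ℂ} {z₀ : ℂ} {U : Set ℂ} (hU : U ∈ 𝓝 z₀)
    (hf : HarmonicAt f z₀) (hc : ContinuousOn f U) (hinj : InjOn f U) :
    (dx f z₀).re * (dy f z₀).im - (dx f z₀).im * (dy f z₀).re ≠ 0 := by
  intro hJ
  -- A degenerate differential is annihilated by a nonzero real functional, so a Re f + b Im f is
  -- critical at z₀; the orthogonal combination serves as the second coordinate.
  obtain ⟨a, b, hab, hx, hy⟩ : ∃ a b : ℝ, a ^ 2 + b ^ 2 ≠ 0 ∧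
      a * (dx f z₀).re + b * (dx f z₀).im = 0 ∧ a * (dy f z₀).re + b * (dy f z₀).im = 0 := by
    have hsq : ∀ p : ℂ, p ≠ 0 → (-p.im) ^ 2 + p.re ^ 2 ≠ 0 := fun p hp => by
      have := normSq_eq_zero.not.mpr hp
      rw [normSq_apply] at this
      intro h; apply this; nlinarith
    by_cases hp : dx f z₀ = 0
    · by_cases hq : dy f z₀ = 0
      · exact ⟨1, 0, by norm_num, by simp [hp], by simp [hq]⟩
      · exact ⟨-(dy f z₀).im, (dy f z₀).re, hsq _ hq, by simp [hp], by ring⟩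
    · exact ⟨-(dx f z₀).im, (dx f z₀).re, hsq _ hp, by ring, by linarith⟩
  refine fderiv_ne_zero_of_injOn (u := (a • reCLM + b • imCLM) ∘ f)
    (v := fun z => -b * (f z).re + a * (f z).im) hU (hf.comp_CLM _)
    (by fun_prop) ?_ ?_
  · intro z hz w hw h
    simp only [Function.comp_apply, Prod.mk.injEq] at h
    obtain ⟨h1, h2⟩ := h
    simp at h1
    refine hinj hz hw (Complex.ext ?_ ?_)
    · refine mul_left_cancel₀ hab ?_
      linear_combination a * h1 - b * h2
    · refine mul_left_cancel₀ hab ?_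
      linear_combination b * h1 + a * h2
  · have hd := (hf.1.differentiableAt (by norm_num)).hasFDerivAt
    rw [((a • reCLM + b • imCLM).hasFDerivAt.comp z₀ hd).fderiv]
    ext z
    have : fderiv ℝ f z₀ z = z.re • dx f z₀ + z.im • dy f z₀ := by
      rw [dx, dy, ← map_smul, ← map_smul, ← map_add]
      congr 1
      simp
    simp [this]
    linear_combination z.re * hx + z.im * hy

/-! ### Harmonic functions under composition, and reduction to a positive Jacobian -/

section Harmonic

/-- Locally u is the real part of a holomorphic function, and holomorphy survives composition. -/
theorem harmonicAt_comp_analyticAt_real {u : ℂ → ℝ} {E : ℂ → ℂ} {z : ℂ} (hu : HarmonicAt u (E z))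
    (hE : AnalyticAt ℂ E z) : HarmonicAt (fun ζ => u (E ζ)) z := by
  obtain ⟨ρ, hρ, hsub⟩ := Metric.isOpen_iff.mp (isOpen_setOfPred_harmonicAt u) _ hu
  obtain ⟨F, hF, hFu⟩ := HarmonicOnNhd.exists_analyticOnNhd_ball_re_eq fun y hy => hsub hy
  have h1 : AnalyticAt ℂ (fun ζ => F (E ζ)) z := (hF _ (Metric.mem_ball_self hρ)).comp hE
  refine (harmonicAt_congr_nhds ?_).mp h1.harmonicAt_re
  filter_upwards [hE.continuousAt (Metric.ball_mem_nhds _ hρ)] with ζ hζ using hFu hζ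

theorem harmonicAt_comp_analyticAt {f E : ℂ → ℂ} {z : ℂ} (hf : HarmonicAt f (E z))
    (hE : AnalyticAt ℂ E z) : HarmonicAt (fun ζ => f (E ζ)) z := by
  have h1 := (harmonicAt_comp_analyticAt_real (hf.comp_CLM reCLM) hE).comp_CLM ofRealCLM
  have h2 := (harmonicAt_comp_analyticAt_real (hf.comp_CLM imCLM) hE).comp_CLM (I • ofRealCLM)
  refine (harmonicAt_congr_nhds (Eventually.of_forall fun ζ => ?_)).mp (h1.add h2)
  simp [mul_comm I]

theorem contDiffAt_of_harmonicAt {f : ℂ → ℂ} {z : ℂ} (hf : HarmonicAt f z) :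
    ContDiffAt ℝ ∞ f z := by
  have h1 := (HarmonicAt.analyticAt (hf.comp_CLM reCLM)).contDiffAt (n := ∞)
  have h2 := (HarmonicAt.analyticAt (hf.comp_CLM imCLM)).contDiffAt (n := ∞)
  have h3 := (ofRealCLM.contDiff.contDiffAt.comp z h1).add
    ((I • ofRealCLM : ℝ →L[ℝ] ℂ).contDiff.contDiffAt.comp z h2)
  refine h3.congr_of_eventuallyEq (Eventually.of_forall fun ζ => ?_)
  simp [mul_comm I]

theorem dx_dx_add_dy_dy_of_harmonicAt {f : ℂ → ℂ} {z : ℂ} (hf : HarmonicAt f z) :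
    dx (dx f) z + dy (dy f) z = 0 := by
  have h := hf.2.self_of_nhds
  have hd : DifferentiableAt ℝ (fderiv ℝ f) z :=
    ((contDiffAt_of_harmonicAt hf).fderiv_right (m := ∞) (by simp)).differentiableAt (by simp)
  have e : ∀ v : ℂ, fderiv ℝ (fun y => fderiv ℝ f y v) z v = fderiv ℝ (fderiv ℝ f) z v v := by
    intro v
    rw [fderiv_clm_apply hd (differentiableAt_const v)]
    simp
  rw [laplacian_eq_iteratedFDeriv_complexPlane] at h
  simp only [iteratedFDeriv_two_apply, Matrix.cons_val_zero, Matrix.cons_val_one,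
    Pi.zero_apply] at h
  rw [← e, ← e] at h
  exact h

theorem fderiv_conj_comp (f : ℂ → ℂ) (z v : ℂ) :
    fderiv ℝ (fun ζ => conj (f ζ)) z v = conj (fderiv ℝ f z v) := by
  have := conjCLE.comp_fderiv (f := f) (x := z)
  exact DFunLike.congr_fun this v

end Harmonic

/-- A harmonic, locally injective, `2πi`-periodic map of the strip `0 < re z < T` into the annulus
`1 < ‖w‖ < σ`. -/
structure IsHarmonicStripImmersion (T σ : ℝ) (f : ℂ → ℂ) : Prop where
  harmonic : ∀ z ∈ strip T, HarmonicAt f z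
  periodic : Function.Periodic f (2 * π * I)
  one_lt : ∀ z ∈ strip T, 1 < ‖f z‖
  lt : ∀ z ∈ strip T, ‖f z‖ < σ
  locally_injective : ∀ z ∈ strip T, ∃ U ∈ 𝓝 z, InjOn f U

namespace IsHarmonicStripImmersion

variable {T σ : ℝ} {f : ℂ → ℂ}

theorem smooth (h : IsHarmonicStripImmersion T σ f) : ContDiffOn ℝ ∞ f (strip T) :=
  fun z hz => (contDiffAt_of_harmonicAt (h.harmonic z hz)).contDiffWithinAt

theorem conj_comp (h : IsHarmonicStripImmersion T σ f) :
    IsHarmonicStripImmersion T σ (fun z => conj (f z)) where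
  harmonic z hz := (h.harmonic z hz).comp_CLM (conjCLE : ℂ →L[ℝ] ℂ)
  periodic z := congrArg _ (h.periodic z)
  one_lt z hz := by simpa using h.one_lt z hz
  lt z hz := by simpa using h.lt z hz
  locally_injective z hz := by
    obtain ⟨U, hU, hi⟩ := h.locally_injective z hz
    exact ⟨U, hU, fun x hx y hy hxy => hi hx hy ((starRingEnd ℂ).injective hxy)⟩

theorem reflect (h : IsHarmonicStripImmersion T σ f) :
    IsHarmonicStripImmersion T σ (fun z => f (T - z)) := by
  have hm : ∀ z ∈ strip T, (T - z : ℂ) ∈ strip T := fun z hz => by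
    constructor
    · simpa using hz.2
    · simpa using hz.1
  refine ⟨fun z hz => harmonicAt_comp_analyticAt (h.harmonic _ (hm z hz))
    (analyticAt_const.sub analyticAt_id), fun z => ?_, fun z hz => h.one_lt _ (hm z hz),
    fun z hz => h.lt _ (hm z hz), fun z hz => ?_⟩
  · show f (T - (z + 2 * π * I)) = f (T - z)
    rw [← h.periodic (T - (z + 2 * π * I))]; congr 1; ring
  · obtain ⟨U, hU, hi⟩ := h.locally_injective _ (hm z hz)
    have hc : ContinuousAt (fun z : ℂ => T - z) z := by fun_prop
    exact ⟨_, hc hU, fun x hx y hy hxy => by simpa using hi hx hy hxy⟩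

theorem jacobian_ne_zero (h : IsHarmonicStripImmersion T σ f) {z : ℂ} (hz : z ∈ strip T) :
    (dx f z).re * (dy f z).im - (dx f z).im * (dy f z).re ≠ 0 := by
  obtain ⟨U, hU, hi⟩ := h.locally_injective z hz
  exact jacobian_ne_zero_of_injOn (inter_mem hU ((isOpen_strip T).mem_nhds hz)) (h.harmonic z hz)
    (h.smooth.continuousOn.mono inter_subset_right) (hi.mono inter_subset_left)

theorem jacobian_sign (h : IsHarmonicStripImmersion T σ f) :
    (∀ z ∈ strip T, 0 < (dx f z).re * (dy f z).im - (dx f z).im * (dy f z).re) ∨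
      ∀ z ∈ strip T, (dx f z).re * (dy f z).im - (dx f z).im * (dy f z).re < 0 := by
  have cx := (contDiffOn_dx h.smooth).continuousOn
  have cy := (contDiffOn_dy h.smooth).continuousOn
  have hc : ContinuousOn (fun z => (dx f z).re * (dy f z).im - (dx f z).im * (dy f z).re)
      (strip T) :=
    ((continuous_re.comp_continuousOn cx).mul (continuous_im.comp_continuousOn cy)).sub
      ((continuous_im.comp_continuousOn cx).mul (continuous_re.comp_continuousOn cy))
  by_contra! hcon
  obtain ⟨⟨z, hz, hz0⟩, w, hw, hw0⟩ := hcon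
  obtain ⟨x, hx, hx0⟩ := (convex_strip T).isPreconnected.intermediate_value hz hw hc ⟨hz0, hw0⟩
  exact h.jacobian_ne_zero hx hx0

theorem cosh_le_of_inner_outer (h : IsHarmonicStripImmersion T σ f) (hσ : 1 < σ) (hT : 0 < T)
    (hT' : T ≤ 3 / 2)
    (inner : ∀ a, 1 < a → ∃ δ, 0 < δ ∧ ∀ z ∈ strip T, z.re < δ → ‖f z‖ < a)
    (outer : ∀ b, b < σ → ∃ δ, 0 < δ ∧ ∀ z ∈ strip T, T - δ < z.re → b < ‖f z‖) :
    Real.cosh T ≤ σ := by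
  rcases h.jacobian_sign with hJ | hJ
  · exact IsHarmonicStripMap.cosh_le (f := f) ⟨h.smooth, h.periodic,
      fun z hz => dx_dx_add_dy_dy_of_harmonicAt (h.harmonic z hz), h.one_lt, h.lt, hJ, inner, outer⟩
      hσ hT hT'
  · have hc := h.conj_comp
    refine IsHarmonicStripMap.cosh_le (f := fun z => starRingEnd ℂ (f z)) ⟨hc.smooth, hc.periodic,
      fun z hz => dx_dx_add_dy_dy_of_harmonicAt (hc.harmonic z hz), hc.one_lt, hc.lt, ?_, ?_, ?_⟩
      hσ hT hT'
    · intro z hz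
      have := hJ z hz
      simp only [dx, dy, fderiv_conj_comp, conj_re, conj_im] at this ⊢
      linarith
    · simpa using inner
    · simpa using outer

theorem cosh_le_of_outer_inner (h : IsHarmonicStripImmersion T σ f) (hσ : 1 < σ) (hT : 0 < T)
    (hT' : T ≤ 3 / 2)
    (inner : ∀ a, 1 < a → ∃ δ, 0 < δ ∧ ∀ z ∈ strip T, T - δ < z.re → ‖f z‖ < a)
    (outer : ∀ b, b < σ → ∃ δ, 0 < δ ∧ ∀ z ∈ strip T, z.re < δ → b < ‖f z‖) :
    Real.cosh T ≤ σ := by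
  have hm : ∀ z ∈ strip T, (T - z : ℂ) ∈ strip T := fun z hz => by
    constructor
    · simpa using hz.2
    · simpa using hz.1
  refine h.reflect.cosh_le_of_inner_outer hσ hT hT' (fun a ha => ?_) fun b hb => ?_
  · obtain ⟨δ, hδ, H⟩ := inner a ha
    exact ⟨δ, hδ, fun z hz hzδ => H _ (hm z hz) (by simpa using hzδ)⟩
  · obtain ⟨δ, hδ, H⟩ := outer b hb
    exact ⟨δ, hδ, fun z hz hzδ => H _ (hm z hz) (by simp; linarith)⟩

end IsHarmonicStripImmersion

/-! ### Behaviour of the modulus at the edges -/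

section Ends

/-- A map whose modulus leaves every compact subinterval of `(1, σ)` along a nested family of
connected sets has modulus tending to one of the ends of the interval. -/
theorem modulus_tendsto_end {f : ℂ → ℂ} {σ : ℝ} {S : ℝ → Set ℂ} (hσ : 1 < σ) (hS : Monotone S)
    (hconn : ∀ δ, IsPreconnected (S δ)) (hcont : ∀ δ, ContinuousOn f (S δ))
    (hprop : ∀ a b, 1 < a → b < σ → ∃ δ, 0 < δ ∧ ∀ z ∈ S δ, ¬(a ≤ ‖f z‖ ∧ ‖f z‖ ≤ b)) :
    (∀ a, 1 < a → ∃ δ, 0 < δ ∧ ∀ z ∈ S δ, ‖f z‖ < a) ∨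
      ∀ b, b < σ → ∃ δ, 0 < δ ∧ ∀ z ∈ S δ, b < ‖f z‖ := by
  obtain ⟨c, hc1, hcσ⟩ := exists_between hσ
  obtain ⟨δ, hδ, H⟩ := hprop c c hc1 hcσ
  have hsign : (∀ z ∈ S δ, ‖f z‖ < c) ∨ ∀ z ∈ S δ, c < ‖f z‖ := by
    by_contra! hcon
    obtain ⟨⟨z, hz, hz0⟩, w, hw, hw0⟩ := hcon
    obtain ⟨x, hx, hx0⟩ := (hconn δ).intermediate_value hw hz (hcont δ).norm ⟨hw0, hz0⟩
    exact H x hx ⟨hx0.ge, hx0.le⟩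
  refine hsign.imp (fun hlow a ha => ?_) fun hhigh b hb => ?_
  · obtain ⟨δ', hδ', H'⟩ := hprop a c ha hcσ
    refine ⟨min δ δ', lt_min hδ hδ', fun z hz => ?_⟩
    by_contra! hcon
    exact H' z (hS (min_le_right _ _) hz) ⟨hcon, (hlow z (hS (min_le_left _ _) hz)).le⟩
  · obtain ⟨δ', hδ', H'⟩ := hprop c b hc1 hb
    refine ⟨min δ δ', lt_min hδ hδ', fun z hz => ?_⟩
    by_contra! hcon
    exact H' z (hS (min_le_right _ _) hz) ⟨(hhigh z (hS (min_le_left _ _) hz)).le, hcon⟩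

theorem exists_pos_le_of_isCompact {K : Set ℂ} (hK : IsCompact K) {q : ℂ → ℝ}
    (hq : ContinuousOn q K) (hpos : ∀ x ∈ K, 0 < q x) : ∃ δ, 0 < δ ∧ ∀ x ∈ K, δ ≤ q x := by
  rcases K.eq_empty_or_nonempty with rfl | hne
  · exact ⟨1, one_pos, by simp⟩
  · obtain ⟨x, hx, hmin⟩ := hK.exists_isMinOn hne hq
    exact ⟨q x, hpos x hx, fun y hy => hmin hy⟩

theorem isCompact_closed_annulus (a b : ℝ) : IsCompact {w : ℂ | a ≤ ‖w‖ ∧ ‖w‖ ≤ b} := by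
  refine Metric.isCompact_of_isClosed_isBounded
    ((isClosed_le continuous_const continuous_norm).inter
      (isClosed_le continuous_norm continuous_const)) ?_
  exact Metric.isBounded_closedBall.subset fun w hw => mem_closedBall_zero_iff.mpr hw.2

end Ends

/-! ### Necessity: from the annulus to the strip -/

section Forward

variable {r R r' R' : ℝ}

theorem norm_real_mul_exp (hr : 0 < r) (z : ℂ) : ‖(r : ℂ) * cexp z‖ = r * Real.exp z.re := by
  rw [norm_mul, norm_real, Real.norm_of_nonneg hr.le, norm_exp]

theorem mul_exp_mem_annulus (hr : 0 < r) (hR : r < R) {z : ℂ} :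
    (r : ℂ) * cexp z ∈ annulus r R ↔ z ∈ strip (Real.log (R / r)) := by
  have h1 : Real.exp z.re < R / r ↔ z.re < Real.log (R / r) :=
    (Real.lt_log_iff_exp_lt (div_pos (hr.trans hR) hr)).symm
  simp only [annulus, strip, mem_ofPred_eq, norm_real_mul_exp hr, ← h1, lt_div_iff₀' hr,
    lt_mul_iff_one_lt_right hr, Real.one_lt_exp_iff]

theorem exists_log_of_mem_annulus (hr : 0 < r) (hR : r < R) {w : ℂ} (hw : w ∈ annulus r R) :
    ∃ z ∈ strip (Real.log (R / r)), (r : ℂ) * cexp z = w := by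
  have hr0 : (r : ℂ) ≠ 0 := by exact_mod_cast hr.ne'
  have hw0 : w ≠ 0 := norm_pos_iff.mp (hr.trans hw.1)
  have e : (r : ℂ) * cexp (Complex.log (w / r)) = w := by
    rw [Complex.exp_log (div_ne_zero hw0 hr0), mul_div_cancel₀ _ hr0]
  exact ⟨_, (mul_exp_mem_annulus hr hR).mp (by rwa [e]), e⟩

theorem cosh_log_le_of_harmonicHomeomorphism (hr : 0 < r) (hR : r < R) (hr' : 0 < r')
    (hR' : r' < R') (hmod : Real.log (R / r) ≤ 3 / 2) {h : OpenPartialHomeomorph ℂ ℂ}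
    (hh : IsHarmonicHomeomorphism h (annulus r R) (annulus r' R')) :
    Real.cosh (Real.log (R / r)) ≤ R' / r' := by
  obtain ⟨hsrc, htgt, hharm⟩ := hh
  have hr0 : (r : ℂ) ≠ 0 := by exact_mod_cast hr.ne'
  obtain ⟨T, hT⟩ : ∃ T, T = Real.log (R / r) := ⟨_, rfl⟩
  obtain ⟨σ, hσd⟩ : ∃ σ, σ = R' / r' := ⟨_, rfl⟩
  rw [← hT, ← hσd]
  rw [← hT] at hmod
  have hσ : 1 < σ := by rw [hσd]; exact (one_lt_div hr').mpr hR'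
  have hT0 : 0 < T := by rw [hT]; exact Real.log_pos ((one_lt_div hr).mpr hR)
  obtain ⟨f, hf⟩ : ∃ f : ℂ → ℂ, f = fun z => r'⁻¹ • h (r * cexp z) := ⟨_, rfl⟩
  have hmem : ∀ z ∈ strip T, (r : ℂ) * cexp z ∈ h.source := fun z hz => by
    rw [hsrc]; exact (mul_exp_mem_annulus hr hR).mpr (hT ▸ hz)
  have hnorm : ∀ z, ‖f z‖ = ‖h (r * cexp z)‖ / r' := fun z => by
    rw [hf]; simp only
    rw [norm_smul, norm_inv, Real.norm_of_nonneg hr'.le, div_eq_inv_mul]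
  have hrange : ∀ z ∈ strip T, 1 < ‖f z‖ ∧ ‖f z‖ < σ := fun z hz => by
    have := h.map_source (hmem z hz)
    rw [htgt] at this
    rw [hnorm, hσd]
    exact ⟨(one_lt_div hr').mpr this.1, (div_lt_div_iff_of_pos_right hr').mpr this.2⟩
  have himm : IsHarmonicStripImmersion T σ f := by
    refine ⟨fun z hz => ?_, fun z => ?_, fun z hz => (hrange z hz).1, fun z hz => (hrange z hz).2,
      fun z hz => ?_⟩
    · rw [hf]
      have h1 := harmonicAt_comp_analyticAt (f := h) (E := fun z => (r : ℂ) * cexp z) (z := z)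
        (hharm _ (hsrc ▸ hmem z hz)) (analyticAt_const.mul analyticAt_cexp)
      exact h1.const_smul
    · rw [hf]; simp only
      rw [Complex.exp_periodic z]
    -- Two points of a ball of radius π differ by less than 2π, so exp is injective there.
    · refine ⟨strip T ∩ Metric.ball z π, inter_mem ((isOpen_strip T).mem_nhds hz)
        (Metric.ball_mem_nhds z Real.pi_pos), fun x hx y hy hxy => ?_⟩
      rw [hf] at hxy
      have h1 := mul_left_cancel₀ hr0 (h.injOn (hmem x hx.1) (hmem y hy.1)
        (smul_right_injective ℂ (inv_ne_zero hr'.ne') hxy))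
      obtain ⟨n, hn⟩ := Complex.exp_eq_exp_iff_exists_int.mp h1
      have hd : ‖x - y‖ < 2 * π := by
        have h2 := dist_triangle_right x y z
        rw [dist_eq] at h2
        linarith [Metric.mem_ball.mp hx.2, Metric.mem_ball.mp hy.2]
      rw [hn, add_sub_cancel_left, norm_mul, norm_mul, norm_mul, norm_I, norm_real, mul_one,
        Real.norm_of_nonneg Real.pi_pos.le, norm_intCast] at hd
      simp at hd
      have h3 : |(n : ℝ)| < 1 := by
        by_contra! hcon
        nlinarith [Real.pi_pos]
      have h4 : n = 0 := Int.abs_lt_one_iff.mp (by exact_mod_cast h3)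
      rw [hn, h4]; simp
  -- The inverse carries a compact subannulus to a compact set, which stays away from both boundary
  -- circles.
  have hproper : ∀ a b, 1 < a → b < σ → ∃ δ, 0 < δ ∧ ∀ z ∈ strip T,
      (z.re < δ ∨ T - δ < z.re) → ¬(a ≤ ‖f z‖ ∧ ‖f z‖ ≤ b) := by
    intro a b ha hb
    obtain ⟨K, hK⟩ : ∃ K, K = {w : ℂ | a * r' ≤ ‖w‖ ∧ ‖w‖ ≤ b * r'} := ⟨_, rfl⟩
    have hKc : IsCompact K := hK ▸ isCompact_closed_annulus _ _
    have hKt : K ⊆ h.target := by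
      rw [htgt, hK]
      intro w hw
      exact ⟨lt_of_lt_of_le (by nlinarith) hw.1,
        lt_of_le_of_lt hw.2 ((lt_div_iff₀ hr').mp (hσd ▸ hb))⟩
    have hpos : ∀ w ∈ K, 0 < ‖h.symm w‖ / r := fun w hw => by
      have := h.map_target (hKt hw)
      rw [hsrc] at this
      exact div_pos (hr.trans this.1) hr
    have hc : ContinuousOn (fun w => Real.log (‖h.symm w‖ / r)) K :=
      ((h.continuousOn_symm.mono hKt).norm.div_const r).log fun w hw => (hpos w hw).ne'
    obtain ⟨δ, hδ, H⟩ := exists_pos_le_of_isCompact hKc 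
      (q := fun w => min (Real.log (‖h.symm w‖ / r)) (T - Real.log (‖h.symm w‖ / r)))
      (continuous_min.comp_continuousOn (hc.prodMk (continuousOn_const.sub hc)))
      (fun w hw => by
        have hs := h.map_target (hKt hw)
        rw [hsrc] at hs
        refine lt_min (Real.log_pos ((one_lt_div hr).mpr hs.1)) (sub_pos.mpr ?_)
        rw [hT]
        exact Real.log_lt_log (hpos w hw) ((div_lt_div_iff_of_pos_right hr).mpr hs.2))
    refine ⟨δ, hδ, fun z hz hzδ hcon => ?_⟩
    rw [hnorm, le_div_iff₀ hr', div_le_iff₀ hr'] at hcon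
    have h1 := H (h (r * cexp z)) (hK ▸ hcon)
    rw [h.left_inv (hmem z hz), norm_real_mul_exp hr, mul_div_cancel_left₀ _ hr.ne',
      Real.log_exp, le_min_iff] at h1
    rcases hzδ with h2 | h2 <;> linarith
  have hmiddle : ∀ δ, 0 < δ → ∃ ε, 0 < ε ∧ ∀ z ∈ strip T, δ ≤ z.re → z.re ≤ T - δ →
      1 + ε ≤ ‖f z‖ ∧ ‖f z‖ ≤ σ - ε := by
    intro δ hδ
    obtain ⟨K, hK⟩ : ∃ K, K = {w : ℂ | r * Real.exp δ ≤ ‖w‖ ∧ ‖w‖ ≤ r * Real.exp (T - δ)} :=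
      ⟨_, rfl⟩
    have hKs : K ⊆ h.source := by
      rw [hsrc, hK]
      intro w hw
      refine ⟨lt_of_lt_of_le ?_ hw.1, lt_of_le_of_lt hw.2 ?_⟩
      · exact (lt_mul_iff_one_lt_right hr).mpr (Real.one_lt_exp_iff.mpr hδ)
      · rw [← lt_div_iff₀' hr, ← Real.lt_log_iff_exp_lt (div_pos (hr.trans hR) hr), ← hT]
        linarith
    have hc : ContinuousOn (fun w => ‖h w‖ / r') K := (h.continuousOn.mono hKs).norm.div_const r'
    obtain ⟨ε, hε, H⟩ := exists_pos_le_of_isCompact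
      (show IsCompact K from hK ▸ isCompact_closed_annulus _ _)
      (q := fun w => min (‖h w‖ / r' - 1) (σ - ‖h w‖ / r'))
      (continuous_min.comp_continuousOn ((hc.sub continuousOn_const).prodMk
        (continuousOn_const.sub hc))) (fun w hw => by
        have hs := h.map_source (hKs hw)
        rw [htgt] at hs
        refine lt_min (sub_pos.mpr ((one_lt_div hr').mpr hs.1)) (sub_pos.mpr ?_)
        rw [hσd]
        exact (div_lt_div_iff_of_pos_right hr').mpr hs.2)
    refine ⟨ε, hε, fun z hz h1 h2 => ?_⟩
    have h3 : (r : ℂ) * cexp z ∈ K := by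
      rw [hK, mem_ofPred_eq, norm_real_mul_exp hr]
      exact ⟨by gcongr, by gcongr⟩
    have h4 := H _ h3
    rw [← hnorm, le_min_iff] at h4
    constructor <;> linarith
  have hsurj : ∀ x, 1 < x → x < σ → ∃ z ∈ strip T, ‖f z‖ = x := by
    intro x h1 h2
    have hx : ((x * r' : ℝ) : ℂ) ∈ h.target := by
      rw [htgt]
      have : ‖((x * r' : ℝ) : ℂ)‖ = x * r' := by
        rw [norm_real, Real.norm_of_nonneg (by positivity)]
      refine ⟨?_, ?_⟩
      · rw [this]; nlinarith
      · rw [this]; exact (lt_div_iff₀ hr').mp (hσd ▸ h2)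
    have hs := h.map_target hx
    rw [hsrc] at hs
    obtain ⟨z, hz, hze⟩ := exists_log_of_mem_annulus hr hR hs
    refine ⟨z, hT ▸ hz, ?_⟩
    rw [hnorm, hze, h.right_inv hx, norm_real, Real.norm_of_nonneg (by positivity)]
    field_simp
  have hcont := himm.smooth.continuousOn
  have hleft := modulus_tendsto_end (f := f) (S := fun δ => strip T ∩ {z | z.re < δ}) hσ
    (fun δ δ' hd z hz => ⟨hz.1, lt_of_lt_of_le hz.2 hd⟩)
    (fun δ => ((convex_strip T).inter (convex_halfSpace_re_lt δ)).isPreconnected)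
    (fun δ => hcont.mono inter_subset_left)
    (fun a b ha hb => by
      obtain ⟨δ, hδ, H⟩ := hproper a b ha hb
      exact ⟨δ, hδ, fun z hz => H z hz.1 (Or.inl hz.2)⟩)
  have hright := modulus_tendsto_end (f := f) (S := fun δ => strip T ∩ {z | T - δ < z.re}) hσ
    (fun δ δ' hd z hz => ⟨hz.1, lt_of_le_of_lt (sub_le_sub_left hd T) hz.2⟩)
    (fun δ => ((convex_strip T).inter (convex_halfSpace_re_gt (T - δ))).isPreconnected)
    (fun δ => hcont.mono inter_subset_left)
    (fun a b ha hb => by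
      obtain ⟨δ, hδ, H⟩ := hproper a b ha hb
      exact ⟨δ, hδ, fun z hz => H z hz.1 (Or.inr hz.2)⟩)
  simp only [mem_inter_iff, mem_ofPred_eq, and_imp] at hleft hright
  obtain ⟨c, hc1, hcσ⟩ := exists_between hσ
  -- If both edges went to the same circle, values of modulus near the other one could come only
  -- from a compact middle part, where the modulus stays away from the ends; this contradicts
  -- surjectivity.
  rcases hleft with hl | hl <;> rcases hright with hr | hr
  · exfalso
    obtain ⟨δ₁, hδ₁, H₁⟩ := hl c hc1
    obtain ⟨δ₂, hδ₂, H₂⟩ := hr c hc1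
    obtain ⟨ε, hε, H⟩ := hmiddle (min δ₁ δ₂) (lt_min hδ₁ hδ₂)
    obtain ⟨x, hx, hxσ⟩ := exists_between (max_lt hcσ (sub_lt_self σ hε))
    obtain ⟨z, hz, rfl⟩ := hsurj x (hc1.trans ((le_max_left _ _).trans_lt hx)) hxσ
    have hxc := (le_max_left _ _).trans_lt hx
    have h1 : δ₁ ≤ z.re := by
      by_contra! hcon; exact lt_asymm hxc (H₁ z hz hcon)
    have h2 : z.re ≤ T - δ₂ := by
      by_contra! hcon; exact lt_asymm hxc (H₂ z hz hcon)
    have h3 := (H z hz ((min_le_left _ _).trans h1)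
      (h2.trans (sub_le_sub_left (min_le_right _ _) _))).2
    exact absurd ((le_max_right _ _).trans_lt hx) (not_lt.mpr h3)
  · exact himm.cosh_le_of_inner_outer hσ hT0 hmod hl hr
  · exact himm.cosh_le_of_outer_inner hσ hT0 hmod hr hl
  · exfalso
    obtain ⟨δ₁, hδ₁, H₁⟩ := hl c hcσ
    obtain ⟨δ₂, hδ₂, H₂⟩ := hr c hcσ
    obtain ⟨ε, hε, H⟩ := hmiddle (min δ₁ δ₂) (lt_min hδ₁ hδ₂)
    obtain ⟨x, hx1, hx⟩ := exists_between (lt_min hc1 (lt_add_of_pos_right 1 hε))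
    obtain ⟨z, hz, rfl⟩ := hsurj x hx1 ((hx.trans_le (min_le_left _ _)).trans hcσ)
    have hxc := hx.trans_le (min_le_left _ _)
    have h1 : δ₁ ≤ z.re := by
      by_contra! hcon; exact lt_asymm hxc (H₁ z hz hcon)
    have h2 : z.re ≤ T - δ₂ := by
      by_contra! hcon; exact lt_asymm hxc (H₂ z hz hcon)
    have h3 := (H z hz ((min_le_left _ _).trans h1)
      (h2.trans (sub_le_sub_left (min_le_right _ _) _))).1
    exact absurd (hx.trans_le (min_le_right _ _)) (not_lt.mpr h3)

end Forward

/-! ### Sufficiency: radial harmonic homeomorphisms -/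

section Converse

/-- The radial self-map of the plane with radial profile `G`. -/
noncomputable def radialMap (G : ℝ → ℝ) (z : ℂ) : ℂ := (G ‖z‖ / ‖z‖ : ℝ) * z

theorem norm_radialMap {G : ℝ → ℝ} {z : ℂ} (hz : 0 < ‖z‖) (hG : 0 ≤ G ‖z‖) :
    ‖radialMap G z‖ = G ‖z‖ := by
  rw [radialMap, norm_mul, norm_real, Real.norm_of_nonneg (by positivity), div_mul_cancel₀ _ hz.ne']

theorem radialMap_radialMap {G H : ℝ → ℝ} {z : ℂ} (hz : 0 < ‖z‖) (hG : 0 < G ‖z‖)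
    (hGH : H (G ‖z‖) = ‖z‖) : radialMap H (radialMap G z) = z := by
  rw [radialMap, norm_radialMap hz hG.le, hGH, radialMap, ← mul_assoc, ← ofReal_mul,
    div_mul_div_cancel₀ hG.ne', div_self hz.ne', ofReal_one, one_mul]

theorem continuousOn_radialMap {G : ℝ → ℝ} {r R : ℝ} (hr : 0 < r) (hG : ContinuousOn G (Ioo r R)) :
    ContinuousOn (radialMap G) (annulus r R) := by
  have h1 : ContinuousOn (fun z : ℂ => G ‖z‖ / ‖z‖) (annulus r R) :=
    (hG.comp continuous_norm.continuousOn fun z hz => hz).div continuous_norm.continuousOn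
      fun z hz => (hr.trans hz.1).ne'
  exact (continuous_ofReal.comp_continuousOn h1).mul continuousOn_id

theorem isOpen_annulus (r R : ℝ) : IsOpen (annulus r R) :=
  (isOpen_lt continuous_const continuous_norm).inter (isOpen_lt continuous_norm continuous_const)

/-- A homeomorphism between intervals induces a radial homeomorphism between annuli. -/
noncomputable def radialHomeomorph {G H : ℝ → ℝ} {r R r' R' : ℝ} (hr : 0 < r) (hr' : 0 < r')
    (hG : MapsTo G (Ioo r R) (Ioo r' R')) (hH : MapsTo H (Ioo r' R') (Ioo r R))
    (hGH : ∀ x ∈ Ioo r R, H (G x) = x) (hHG : ∀ y ∈ Ioo r' R', G (H y) = y)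
    (hGc : ContinuousOn G (Ioo r R)) (hHc : ContinuousOn H (Ioo r' R')) :
    OpenPartialHomeomorph ℂ ℂ where
  toFun := radialMap G
  invFun := radialMap H
  source := annulus r R
  target := annulus r' R'
  map_source' z hz := by
    have h := hG hz
    have := norm_radialMap (hr.trans hz.1) (hr'.trans h.1).le
    exact ⟨this ▸ h.1, this ▸ h.2⟩
  map_target' z hz := by
    have h := hH hz
    have := norm_radialMap (hr'.trans hz.1) (hr.trans h.1).le
    exact ⟨this ▸ h.1, this ▸ h.2⟩
  left_inv' z hz := radialMap_radialMap (hr.trans hz.1) (hr'.trans (hG hz).1) (hGH _ hz)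
  right_inv' z hz := radialMap_radialMap (hr'.trans hz.1) (hr.trans (hH hz).1) (hHG _ hz)
  open_source := isOpen_annulus r R
  open_target := isOpen_annulus r' R'
  continuousOn_toFun := continuousOn_radialMap hr hGc
  continuousOn_invFun := continuousOn_radialMap hr' hHc

/-- Since z/|z|² = 1/conj z, the map is a z + b / conj z, a holomorphic plus an antiholomorphic
function. -/
theorem harmonicAt_radialMap {a b : ℝ} {z : ℂ} (hz : z ≠ 0) :
    HarmonicAt (radialMap fun x => a * x + b / x) z := by
  have h1 : HarmonicAt (fun z : ℂ => a * z) z :=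
    (analyticAt_const.mul analyticAt_id).harmonicAt
  have h2 : HarmonicAt (fun z : ℂ => b * z⁻¹) z :=
    (analyticAt_const.mul (analyticAt_id.inv hz)).harmonicAt
  refine (harmonicAt_congr_nhds ?_).mp (h1.add (h2.comp_CLM (conjCLE : ℂ →L[ℝ] ℂ)))
  filter_upwards [eventually_ne_nhds hz] with w hw
  have hn : (‖w‖ : ℂ) ≠ 0 := by exact_mod_cast (norm_pos_iff.mpr hw).ne'
  have hc : conj w ≠ 0 := (map_ne_zero _).mpr hw
  have e : w * conj w = (‖w‖ : ℂ) ^ 2 := mul_conj' w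
  simp [radialMap]
  field_simp
  rw [← e]
  ring

theorem exists_harmonicHomeomorphism {r R r' R' : ℝ} (hr : 0 < r) (hR : r < R) (hr' : 0 < r')
    (hR' : r' < R') (hN : 1 / 2 * (R / r + r / R) ≤ R' / r') :
    ∃ h : OpenPartialHomeomorph ℂ ℂ, IsHarmonicHomeomorphism h (annulus r R) (annulus r' R') := by
  have hR0 : 0 < R := hr.trans hR
  have hd : 0 < R ^ 2 - r ^ 2 := by nlinarith
  obtain ⟨a, ha⟩ : ∃ a, a = (R * R' - r * r') / (R ^ 2 - r ^ 2) := ⟨_, rfl⟩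
  obtain ⟨b, hb⟩ : ∃ b, b = r * r' - a * r ^ 2 := ⟨_, rfl⟩
  have hN' : r' * (R ^ 2 + r ^ 2) ≤ 2 * (r * (R * R')) := by
    have h1 : 1 / 2 * (R / r + r / R) = (R ^ 2 + r ^ 2) / (2 * (r * R)) := by field_simp
    rw [h1, div_le_div_iff₀ (by positivity) hr'] at hN
    linarith
  -- The Nitsche inequality in terms of the profile a x + b/x: its derivative a - b/x² is
  -- nonnegative at x = r.
  have hab : b ≤ a * r ^ 2 := by
    have h1 : r * r' ≤ 2 * (a * r ^ 2) := by
      have : 2 * (a * r ^ 2) = r * (2 * (r * (R * R') - r ^ 2 * r')) / (R ^ 2 - r ^ 2) := by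
        rw [ha]; field_simp
      rw [this, le_div_iff₀ hd]
      nlinarith
    linarith
  have ha0 : 0 < a := by
    rw [ha]; exact div_pos (by nlinarith) hd
  obtain ⟨G, hGd⟩ : ∃ G : ℝ → ℝ, G = fun x => a * x + b / x := ⟨_, rfl⟩
  -- The larger root of a x² - y x + b = 0, the one beyond r, where the profile increases.
  obtain ⟨H, hHd⟩ : ∃ H : ℝ → ℝ, H = fun y => (y + √(y ^ 2 - 4 * a * b)) / (2 * a) := ⟨_, rfl⟩
  have hGr : G r = r' := by rw [hGd, hb]; field_simp; ring
  have hGR : G R = R' := by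
    rw [hGd, hb, ha]; field_simp; ring
  have hmono : StrictMonoOn G (Ici r) := by
    intro x hx y hy hxy
    have hx' : r ≤ x := hx
    have hx0 : 0 < x := hr.trans_le hx'
    have hy0 : 0 < y := hx0.trans hxy
    have h1 : G y - G x = (y - x) * (a * (x * y) - b) / (x * y) := by
      rw [hGd]; field_simp; ring
    have h2 : 0 < a * (x * y) - b := by
      have : r ^ 2 < x * y := by nlinarith
      nlinarith
    have : 0 < (y - x) * (a * (x * y) - b) / (x * y) := by
      have : 0 < y - x := sub_pos.mpr hxy
      positivity
    linarith
  have hdisc : ∀ y, r' < y → 0 ≤ y ^ 2 - 4 * a * b := by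
    intro y hy
    -- As a r² and b add up to r r', four times their product is at most (r r')².
    have h1 : r ^ 2 * (4 * a * b) ≤ r ^ 2 * r' ^ 2 := by
      rw [hb]; nlinarith [sq_nonneg (r * r' - 2 * a * r ^ 2)]
    have h2 := le_of_mul_le_mul_left h1 (by positivity)
    nlinarith
  have hHr : ∀ y, r' < y → r < H y := by
    intro y hy
    have h1 : 2 * a * r - r' ≤ √(y ^ 2 - 4 * a * b) := by
      refine Real.le_sqrt_of_sq_le ?_
      have : r * ((2 * a * r - r') ^ 2) = r * (r' ^ 2 - 4 * a * b) := by rw [hb]; ring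
      have := mul_left_cancel₀ hr.ne' this
      nlinarith
    rw [hHd]; simp only
    rw [lt_div_iff₀ (by positivity)]
    linarith
  have hGH : ∀ y, r' < y → G (H y) = y := by
    intro y hy
    have hp := hr.trans (hHr y hy)
    have h1 : a * H y ^ 2 + b = y * H y := by
      have hs := Real.sq_sqrt (hdisc y hy)
      rw [hHd]; simp only
      generalize √(y ^ 2 - 4 * a * b) = D at hs ⊢
      field_simp
      linear_combination hs
    have h2 : G (H y) * H y = y * H y := by
      rw [← h1, hGd]; field_simp
    exact mul_right_cancel₀ hp.ne' h2
  have hG : MapsTo G (Ioo r R) (Ioo r' R') := fun x hx =>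
    ⟨hGr ▸ hmono (self_mem_Ici) hx.1.le hx.1, hGR ▸ hmono hx.1.le hR.le hx.2⟩
  have hH : MapsTo H (Ioo r' R') (Ioo r R) := fun y hy => by
    refine ⟨hHr y hy.1, ?_⟩
    by_contra! hcon
    have := hmono.monotoneOn hR.le (hHr y hy.1).le hcon
    rw [hGR, hGH y hy.1] at this
    exact absurd hy.2 (not_lt.mpr this)
  have hGc : ContinuousOn G (Ioo r R) := by
    rw [hGd]
    exact (continuousOn_const.mul continuousOn_id).add
      (continuousOn_const.div continuousOn_id fun x hx => (hr.trans hx.1).ne')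
  refine ⟨radialHomeomorph hr hr' hG hH (fun x hx => ?_) (fun y hy => hGH y hy.1) hGc
    (by rw [hHd]; fun_prop), rfl, rfl, fun z hz => ?_⟩
  · exact hmono.injOn (hH (hG hx)).1.le hx.1.le (hGH _ (hG hx).1)
  · show HarmonicAt (radialMap G) z
    rw [hGd]
    exact harmonicAt_radialMap (norm_pos_iff.mp (hr.trans hz.1))

end Converse

theorem mainTheorem1 (r R r' R' : ℝ) (hr : 0 < r) (hrR : r < R) (hr' : 0 < r') (hrR' : r' < R')
    (hmod : Real.log (R / r) ≤ 3 / 2) :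
    (∃ h : OpenPartialHomeomorph ℂ ℂ,
      IsHarmonicHomeomorphism h (annulus r R) (annulus r' R')) ↔
    1 / 2 * (R / r + r / R) ≤ R' / r' := by
  constructor
  · rintro ⟨h, hh⟩
    have := cosh_log_le_of_harmonicHomeomorphism hr hrR hr' hrR' hmod hh
    rw [Real.cosh_log (div_pos (hr.trans hrR) hr), inv_div] at this
    linarith
  · exact exists_harmonicHomeomorphism hr hrR hr' hrR'
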